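/- Let $X$ be a locally compact $\sigma$-compact metric space with a positive Radon measure $\mu$ such that $\operatorname{supp}\mu=X$. Let $\mathcal E$ be a (symmetric) Dirichlet form on the real space $L_2(X)=L_2(X,\mu)$, i.e. a densely defined, nonnegative, symmetric, closed bilinear form such that $0\vee\varphi\wedge \mathbb 1\in D(\mathcal E)$ and $\mathcal E(0\vee\varphi\wedge \mathbb 1)\le\mathcal E(\varphi)$ for all $\varphi\in D(\mathcal E)$, where $\mathcal E(\varphi)=\mathcal E(\varphi,\varphi)$. Write $\|\varphi\|_{D(\mathcal E)}^2=\mathcal E(\varphi)+\|\varphi\|_2^2$ for the square of the graph norm. Assume that $D(\mathcal E)\cap C_c(X)$ is dense in $C_0(X)$ with the supremum norm, and that $\mathcal E$ is local: $\mathcal E(\psi,\varphi)=0$ for all $\varphi,\psi\in D(\mathcal E)$ with $\varphi\,\psi=0$. The form $\mathcal E$ is called regular if moreover $D(\mathcal E)\cap C_c(X)$ is dense in $D(\mathcal E)$ with the graph norm. Let $\Omega\subseteq X$ be open, and identify $L_2(\Omega)$ with the subspace $\{\mathbb 1_\Omega\varphi:\varphi\in L_2(X)\}$ of $L_2(X)$.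 Let $D_\Omega$ be the set of all $\varphi\in D(\mathcal E)$ such that $\operatorname{supp}\varphi$ is a compact subset of $\Omega$, let $\overline{D_\Omega}$ be its closure in $D(\mathcal E)$ with respect to the graph norm, and let $\mathcal E_D$ be the form on $L_2(\Omega)$ with domain $\overline{D_\Omega}$ obtained by restricting $\mathcal E$. Let $S$ and $S^D$ be the semigroups on $L_2(X)$ and $L_2(\Omega)$ associated with $\mathcal E$ and $\mathcal E_D$, respectively; they are submarkovian, and their extensions to $L_\infty(X)$ and $L_\infty(\Omega)$ are denoted by the same symbols. The semigroup $S$ is called conservative if $S_t\mathbb 1=\mathbb 1$ for all $t>0$. For $A\subseteq\overline\Omega$ set $$\operatorname{cap}_\Omega(A)=\inf\{\|\varphi\|_{D(\mathcal E)}^2:\varphi\in D(\mathcal E)\text{ and there is an open }V\subseteq X\text{ with }A\subseteq V\text{ and }\varphi\ge \mathbb 1\text{ a.e. on }V\cap\Omega\}\in[0,\infty].$$ Consider the following conditions. (I) $S^D$ is conservative, i.e. $S^D_t\mathbb 1_\Omega=\mathbb 1_\Omega$ for all $t>0$. (II) $S_t\varphi=S^D_t\varphi$ for all $\varphi\in L_2(\Omega)$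 and $t>0$. (III) $\operatorname{cap}_\Omega(\partial\Omega)=0$. Then (I)$\Rightarrow$(II)$\Rightarrow$(III). In particular each of (I) and (II) implies that $L_2(\Omega)$ is $S$-invariant, i.e. $S_tL_2(\Omega)\subseteq L_2(\Omega)$ for all $t>0$. Moreover, if $S$ is conservative, then (II)$\Rightarrow$(I). Finally, if $\mathcal E$ is regular, then (III)$\Rightarrow$(II). -/

import Mathlib

open Filter Topology MeasureTheory
open scoped ENNReal ZeroAtInfty

namespace ClosedForm

/-- The Riesz representation theorem for a complete positive definite symmetric bilinear form. -/
theorem exists_riesz {V : Type*} [AddCommGroup V] [Module ℝ V] (B : V →ₗ[ℝ] V →ₗ[ℝ] ℝ)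
    (symm : ∀ u v, B u v = B v u) (nonneg : ∀ u, 0 ≤ B u u) (def0 : ∀ u, B u u = 0 → u = 0)
    (complete : ∀ u : ℕ → V,
      (∀ ε : ℝ, 0 < ε → ∃ N, ∀ m ≥ N, ∀ n ≥ N, B (u m - u n) (u m - u n) < ε) →
        ∃ w, Tendsto (fun n => B (u n - w) (u n - w)) atTop (𝓝 0))
    (l : V →ₗ[ℝ] ℝ) (C : ℝ) (hl : ∀ v, |l v| ≤ C * √(B v v)) : ∃ u, ∀ v, B u v = l v := by
  let core : InnerProductSpace.Core ℝ V :=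
    { inner := fun u v => B u v
      conj_inner_symm := fun u v => by simp [symm v u]
      re_inner_nonneg := fun u => by simpa using nonneg u
      add_left := fun u v w => by simp
      smul_left := fun u v r => by simp
      definite := fun u hu => def0 u hu }
  let _ : NormedAddCommGroup V := core.toNormedAddCommGroup
  let _ : InnerProductSpace ℝ V := InnerProductSpace.ofCore core.toCore
  have hin : ∀ u v : V, inner ℝ u v = B u v := fun u v => rfl
  have hn : ∀ v : V, ‖v‖ ^ 2 = B v v := fun v => by
    rw [← hin, real_inner_self_eq_norm_sq]
  have hs : ∀ v : V, √(B v v) = ‖v‖ := fun v => by rw [← hn, Real.sqrt_sq (norm_nonneg _)]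
  have _ : CompleteSpace V := by
    refine Metric.complete_of_cauchySeq_tendsto fun u hu => ?_
    obtain ⟨w, hw⟩ := complete u (fun ε hε => by
      obtain ⟨N, hN⟩ := Metric.cauchySeq_iff.1 hu (√ε) (Real.sqrt_pos.2 hε)
      refine ⟨N, fun m hm n hn' => ?_⟩
      have := hN m hm n hn'
      rw [dist_eq_norm] at this
      rw [← hn]
      exact (Real.lt_sqrt (norm_nonneg _)).1 this)
    refine ⟨w, ?_⟩
    rw [tendsto_iff_norm_sub_tendsto_zero]
    have := (Real.continuous_sqrt.tendsto 0).comp hw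
    simp only [Function.comp_def, hs, Real.sqrt_zero] at this
    exact this
  let L : V →L[ℝ] ℝ := l.mkContinuous C (fun v => by rw [← hs]; exact hl v)
  refine ⟨(InnerProductSpace.toDual ℝ V).symm L, fun v => ?_⟩
  rw [← hin, InnerProductSpace.toDual_symm_apply]
  rfl

end ClosedForm

/-- A nonnegative symmetric closed bilinear form on a real Hilbert space `H`: the domain is a
linear subspace which is complete for the graph norm `(form u u + ‖u‖ ^ 2) ^ (1 / 2)`.
Density of the domain is not part of this structure. -/
structure ClosedForm (H : Type*) [NormedAddCommGroup H] [InnerProductSpace ℝ H] where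
  domain : Submodule ℝ H
  form : domain →ₗ[ℝ] domain →ₗ[ℝ] ℝ
  symm : ∀ u v, form u v = form v u
  nonneg : ∀ u, 0 ≤ form u u
  closed : ∀ u : ℕ → domain,
    (∀ ε : ℝ, 0 < ε → ∃ N, ∀ m ≥ N, ∀ n ≥ N,
      form (u m - u n) (u m - u n) + ‖((u m - u n : domain) : H)‖ ^ 2 < ε) →
    ∃ w : domain,
      Tendsto (fun n => form (u n - w) (u n - w) + ‖((u n - w : domain) : H)‖ ^ 2) atTop (𝓝 0)

namespace ClosedForm

variable {H : Type*} [NormedAddCommGroup H] [InnerProductSpace ℝ H] (E : ClosedForm H)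

/-- The square of the graph norm, `‖u‖_{D(E)} ^ 2 = E(u, u) + ‖u‖ ^ 2`. -/
def normSq (u : E.domain) : ℝ := E.form u u + ‖(u : H)‖ ^ 2

theorem exists_resolvent {β : ℝ} (hβ : 0 < β) (f : H) :
    ∃ u : E.domain, ∀ v : E.domain, E.form u v + β * inner ℝ (u : H) v = inner ℝ f (v : H) := by
  let B : E.domain →ₗ[ℝ] E.domain →ₗ[ℝ] ℝ :=
    E.form + β • ((innerₗ H).domRestrict₁₂ E.domain E.domain)
  have hB : ∀ u v, B u v = E.form u v + β * inner ℝ (u : H) v := fun u v => by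
    simp only [B, LinearMap.add_apply, LinearMap.smul_apply, smul_eq_mul]; rfl
  have hB' : ∀ u, B u u = E.form u u + β * ‖(u : H)‖ ^ 2 := fun u => by
    rw [hB, real_inner_self_eq_norm_sq]
  have key := exists_riesz B (fun u v => by rw [hB, hB, E.symm, real_inner_comm])
    (fun u => by rw [hB']; have := E.nonneg u; positivity)
    (fun u hu => by
      rw [hB'] at hu
      have h1 := E.nonneg u
      have h2 : β * ‖(u : H)‖ ^ 2 = 0 := le_antisymm (by linarith) (by positivity)
      have h3 : ‖(u : H)‖ = 0 := by simpa [hβ.ne'] using h2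
      exact Subtype.ext (norm_eq_zero.1 h3))
    (fun u hu => by
      obtain ⟨w, hw⟩ := E.closed u (fun ε hε => by
        obtain ⟨N, hN⟩ := hu (ε * min 1 β) (by positivity)
        refine ⟨N, fun m hm n hn => ?_⟩
        have h := hN m hm n hn
        rw [hB'] at h
        have h1 := E.nonneg (u m - u n)
        have h2 : 0 ≤ ‖((u m - u n : E.domain) : H)‖ ^ 2 := by positivity
        have hm1 : min 1 β ≤ 1 := min_le_left _ _
        have hm2 : min 1 β ≤ β := min_le_right _ _
        have hm0 : 0 < min 1 β := by positivity
        have h3 : min 1 β * (E.form (u m - u n) (u m - u n) + ‖((u m - u n : E.domain) : H)‖ ^ 2)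
            < min 1 β * ε := by nlinarith
        exact lt_of_mul_lt_mul_left h3 hm0.le)
      refine ⟨w, ?_⟩
      have h0 := hw.const_mul (1 + β)
      rw [mul_zero] at h0
      refine squeeze_zero (fun n => ?_) (fun n => ?_) h0
      · rw [hB']; have := E.nonneg (u n - w); positivity
      · rw [hB']
        have h1 := E.nonneg (u n - w)
        have h2 : 0 ≤ ‖((u n - w : E.domain) : H)‖ ^ 2 := by positivity
        nlinarith)
    ((innerₗ H f).domRestrict E.domain) (‖f‖ / √β) (fun v => by
      have h1 : |inner ℝ f (v : H)| ≤ ‖f‖ * ‖(v : H)‖ := abs_real_inner_le_norm _ _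
      have h2 : √β * ‖(v : H)‖ ≤ √(B v v) := by
        rw [hB']
        apply Real.le_sqrt_of_sq_le
        rw [mul_pow, Real.sq_sqrt hβ.le]
        have := E.nonneg v
        linarith
      have h3 : 0 < √β := Real.sqrt_pos.2 hβ
      calc |inner ℝ f (v : H)| ≤ ‖f‖ / √β * (√β * ‖(v : H)‖) := by
            rw [← mul_assoc, div_mul_cancel₀ _ h3.ne']; exact h1
        _ ≤ _ := by gcongr)
  obtain ⟨u, hu⟩ := key
  exact ⟨u, fun v => by rw [← hB]; exact hu v⟩

theorem resolvent_unique {β : ℝ} (hβ : 0 < β) {u w : E.domain}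
    (h : ∀ v : E.domain, E.form u v + β * inner ℝ (u : H) v =
      E.form w v + β * inner ℝ (w : H) v) : u = w := by
  have h1 := h (u - w)
  have h2 : E.form (u - w) (u - w) + β * ‖((u - w : E.domain) : H)‖ ^ 2 = 0 := by
    rw [← real_inner_self_eq_norm_sq]
    have e1 : E.form (u - w) (u - w) = E.form u (u - w) - E.form w (u - w) := by
      rw [LinearMap.map_sub₂]
    have e2 : inner ℝ ((u - w : E.domain) : H) ((u - w : E.domain) : H) =
        inner ℝ (u : H) ((u - w : E.domain) : H) - inner ℝ (w : H) ((u - w : E.domain) : H) := by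
      rw [← inner_sub_left]; rfl
    rw [e1, e2]; linarith
  have h3 := E.nonneg (u - w)
  have h4 : β * ‖((u - w : E.domain) : H)‖ ^ 2 = 0 := le_antisymm (by linarith) (by positivity)
  have h5 : ‖((u - w : E.domain) : H)‖ = 0 := by simpa [hβ.ne'] using h4
  exact sub_eq_zero.1 (Subtype.ext (norm_eq_zero.1 h5))

/-- `(β + A)⁻¹ f` as an element of the form domain, where `A` is the nonnegative selfadjoint
operator associated with the form (`A u = g` iff `u` is in the domain of the form and
`E(u, v) = ⟪g, v⟫` for all `v` in the domain of the form): the unique `u` in the domain with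
`E(u, v) + β ⟪u, v⟫ = ⟪f, v⟫` for all `v` in the domain. -/
noncomputable def resolventFun {β : ℝ} (hβ : 0 < β) (f : H) : E.domain :=
  (E.exists_resolvent hβ f).choose

theorem resolventFun_spec {β : ℝ} (hβ : 0 < β) (f : H) (v : E.domain) :
    E.form (E.resolventFun hβ f) v + β * inner ℝ (E.resolventFun hβ f : H) v =
      inner ℝ f (v : H) :=
  (E.exists_resolvent hβ f).choose_spec v

theorem norm_resolventFun_le {β : ℝ} (hβ : 0 < β) (f : H) :
    ‖(E.resolventFun hβ f : H)‖ ≤ β⁻¹ * ‖f‖ := by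
  have h := E.resolventFun_spec hβ f (E.resolventFun hβ f)
  rw [real_inner_self_eq_norm_sq] at h
  have h1 := E.nonneg (E.resolventFun hβ f)
  have h2 := real_inner_le_norm f (E.resolventFun hβ f : H)
  rw [inv_mul_eq_div, le_div_iff₀ hβ]
  rcases (norm_nonneg (E.resolventFun hβ f : H)).eq_or_lt with h0 | h0
  · rw [← h0]; simp
  · nlinarith

/-- The resolvent `(β + A)⁻¹`, for `0 < β`, of the operator `A` associated with the form
(with the value `0` for `β ≤ 0`). -/
noncomputable def resolvent (β : ℝ) : H →L[ℝ] H :=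
  if hβ : 0 < β then
    LinearMap.mkContinuous
      { toFun := fun f => (E.resolventFun hβ f : H)
        map_add' := fun f g => by
          rw [← Submodule.coe_add]
          congr 1
          refine E.resolvent_unique hβ fun v => ?_
          have h1 := E.resolventFun_spec hβ f v
          have h2 := E.resolventFun_spec hβ g v
          rw [E.resolventFun_spec, map_add, LinearMap.add_apply, Submodule.coe_add,
            inner_add_left, inner_add_left]
          linarith
        map_smul' := fun c f => by
          rw [RingHom.id_apply, ← Submodule.coe_smul]
          congr 1
          refine E.resolvent_unique hβ fun v => ?_
          have h1 := E.resolventFun_spec hβ f v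
          rw [E.resolventFun_spec, map_smul, LinearMap.smul_apply, Submodule.coe_smul,
            inner_smul_left, inner_smul_left, ← h1, smul_eq_mul]
          simp only [conj_trivial]
          ring }
      β⁻¹ (E.norm_resolventFun_le hβ)
  else 0

theorem resolvent_apply {β : ℝ} (hβ : 0 < β) (f : H) :
    E.resolvent β f = (E.resolventFun hβ f : H) := by
  rw [resolvent, dif_pos hβ]; rfl

theorem resolvent_mem {β : ℝ} (hβ : 0 < β) (f : H) : E.resolvent β f ∈ E.domain := by
  rw [E.resolvent_apply hβ]; exact Subtype.coe_prop _

theorem norm_resolvent_apply_le {β : ℝ} (hβ : 0 < β) (f : H) :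
    ‖E.resolvent β f‖ ≤ β⁻¹ * ‖f‖ := by
  rw [E.resolvent_apply hβ]; exact E.norm_resolventFun_le hβ f

/-- The resolvent identity. -/
theorem resolvent_sub {α β : ℝ} (hα : 0 < α) (hβ : 0 < β) (f : H) :
    E.resolvent α f - E.resolvent β f = (β - α) • E.resolvent β (E.resolvent α f) := by
  rw [sub_eq_iff_eq_add, E.resolvent_apply hα, E.resolvent_apply hβ, E.resolvent_apply hβ,
    ← Submodule.coe_smul, ← Submodule.coe_add]
  congr 1
  refine E.resolvent_unique hβ fun v => ?_
  have h1 := E.resolventFun_spec hα f v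
  have h2 := E.resolventFun_spec hβ f v
  have h3 := E.resolventFun_spec hβ (E.resolventFun hα f : H) v
  simp only [map_add, map_smul, LinearMap.add_apply, LinearMap.smul_apply, Submodule.coe_add,
    Submodule.coe_smul, inner_add_left, inner_smul_left, smul_eq_mul, conj_trivial]
  linear_combination h1 - h2 - (β - α) * h3

theorem resolvent_symm {β : ℝ} (hβ : 0 < β) (f g : H) :
    inner ℝ (E.resolvent β f) g = inner ℝ f (E.resolvent β g) := by
  rw [E.resolvent_apply hβ, E.resolvent_apply hβ]
  have h1 := E.resolventFun_spec hβ f (E.resolventFun hβ g)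
  have h2 := E.resolventFun_spec hβ g (E.resolventFun hβ f)
  rw [← h1, real_inner_comm, ← h2, E.symm, real_inner_comm]

theorem resolvent_commute {α β : ℝ} (hα : 0 < α) (hβ : 0 < β) :
    Commute (E.resolvent α) (E.resolvent β) := by
  rcases eq_or_ne α β with rfl | hne
  · exact Commute.refl _
  · ext f
    have h1 := E.resolvent_sub hα hβ f
    have h2 := E.resolvent_sub hβ hα f
    have h3 : (β - α) • (E.resolvent α (E.resolvent β f)) =
        (β - α) • (E.resolvent β (E.resolvent α f)) := by
      rw [← h1, ← neg_sub α β, neg_smul, ← h2, neg_sub]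
    exact smul_right_injective H (sub_ne_zero.2 hne.symm) h3

/-- The Yosida approximation `β (β (β + A)⁻¹ - 1)` of `-A`. -/
noncomputable def yosida (β : ℝ) : H →L[ℝ] H := β • (β • E.resolvent β - 1)

/-- The semigroup `S_t = exp (-t A)`, for `0 < t`, generated by `-A`, where `A` is the operator
associated with the form, as the strong limit of the exponentials of the Yosida approximations
(Hille and Yosida). The limit exists by `ClosedForm.tendsto_semigroup` below.
If the domain is not dense, then `S_t` is the semigroup on the closure of the domain,
extended by `0` on the orthogonal complement. -/
noncomputable def semigroup (t : ℝ) (f : H) : H :=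
  limUnder atTop fun β : ℝ => NormedSpace.exp (t • E.yosida β) f


theorem exp_smul_apply_of_apply_eq_zero [CompleteSpace H] (A : H →L[ℝ] H) (f : H) (hf : A f = 0) :
    NormedSpace.exp A f = f := by
  have h := NormedSpace.exp_series_hasSum_exp' (𝕂 := ℝ) A
  have h1 := h.mapL (ContinuousLinearMap.apply ℝ H f)
  have h2 : HasSum (fun n : ℕ => (ContinuousLinearMap.apply ℝ H f) ((n.factorial⁻¹ : ℝ) • A ^ n)) f := by
    convert hasSum_single (f := fun n : ℕ => (ContinuousLinearMap.apply ℝ H f)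
      ((n.factorial⁻¹ : ℝ) • A ^ n)) 0 ?_ using 1
    · simp
    · intro n hn
      obtain ⟨k, rfl⟩ := Nat.exists_eq_succ_of_ne_zero hn
      simp [pow_succ, hf]
  exact h1.unique h2

theorem norm_exp_sub_le [CompleteSpace H] {A B : H →L[ℝ] H} (hc : Commute A B)
    (hA : ∀ s : ℝ, 0 ≤ s → ‖NormedSpace.exp (s • A)‖ ≤ 1)
    (hB : ∀ s : ℝ, 0 ≤ s → ‖NormedSpace.exp (s • B)‖ ≤ 1) {t : ℝ} (ht : 0 ≤ t) (f : H) :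
    ‖NormedSpace.exp (t • A) f - NormedSpace.exp (t • B) f‖ ≤ ‖A f - B f‖ * t := by
  have hd : ∀ s : ℝ, HasDerivAt
      (fun s : ℝ => (NormedSpace.exp (s • A) * NormedSpace.exp ((t - s) • B)) f)
      ((NormedSpace.exp (s • A) * NormedSpace.exp ((t - s) • B)) (A f - B f)) s := fun s => by
    have h1 := hasDerivAt_exp_smul_const (𝕂 := ℝ) A s
    have h2 := (hasDerivAt_exp_smul_const' (𝕂 := ℝ) B (t - s)).scomp s
      ((hasDerivAt_id s).const_sub t)
    have h3 := h1.mul h2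
    have hc2 : A * NormedSpace.exp ((t - s) • B) = NormedSpace.exp ((t - s) • B) * A :=
      ((hc.smul_right (t - s)).exp_right).eq
    have hc3 : B * NormedSpace.exp ((t - s) • B) = NormedSpace.exp ((t - s) • B) * B :=
      (((Commute.refl B).smul_right (t - s)).exp_right).eq
    have h5 : NormedSpace.exp (s • A) * A * NormedSpace.exp ((t - s) • B) +
        NormedSpace.exp (s • A) * (-1 : ℝ) • (B * NormedSpace.exp ((t - s) • B)) =
        NormedSpace.exp (s • A) * NormedSpace.exp ((t - s) • B) * (A - B) := by
      rw [mul_assoc, hc2, hc3, neg_one_smul, mul_neg, mul_assoc, mul_sub, mul_sub, ← sub_eq_add_neg]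
    have h4 := h3.clm_apply (hasDerivAt_const s f)
    have h6 : (NormedSpace.exp (s • A) * NormedSpace.exp ((t - s) • B)) (A f - B f) =
        (NormedSpace.exp (s • A) * NormedSpace.exp ((t - s) • B) * (A - B)) f := rfl
    rw [h6, ← h5]
    rw [map_zero, add_zero] at h4
    exact h4
  have hb := norm_image_sub_le_of_norm_deriv_le_segment' (a := 0) (b := t) (C := ‖A f - B f‖)
    (fun s _ => (hd s).hasDerivWithinAt) (fun s hs => by
      have h1 := hA s hs.1
      have h2 := hB (t - s) (by linarith [hs.2])
      calc _ ≤ ‖NormedSpace.exp (s • A)‖ * (‖NormedSpace.exp ((t - s) • B)‖ * ‖A f - B f‖) :=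
            (ContinuousLinearMap.le_opNorm _ _).trans (by
              rw [← mul_assoc]
              gcongr
              exact norm_mul_le _ _)
        _ ≤ 1 * (1 * ‖A f - B f‖) := by gcongr
        _ = _ := by ring) t ⟨ht, le_rfl⟩
  simpa using hb

theorem norm_exp_le [CompleteSpace H] (A : H →L[ℝ] H) :
    ‖NormedSpace.exp A‖ ≤ Real.exp ‖A‖ := by
  rw [NormedSpace.exp_eq_tsum ℝ]
  refine tsum_of_norm_bounded (g := fun n : ℕ => ‖A‖ ^ n / n.factorial) ?_ fun n => ?_
  · rw [Real.exp_eq_exp_ℝ]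
    exact NormedSpace.expSeries_div_hasSum_exp ‖A‖
  · rw [norm_smul, norm_inv, RCLike.norm_natCast, inv_mul_eq_div]
    gcongr
    rcases Nat.eq_zero_or_pos n with rfl | hn
    · rw [pow_zero, pow_zero]; exact ContinuousLinearMap.norm_id_le
    · exact norm_pow_le' A hn

theorem exp_yosida_eq [CompleteSpace H] (β t : ℝ) :
    NormedSpace.exp (t • E.yosida β) =
      Real.exp (-(t * β)) • NormedSpace.exp ((t * β ^ 2) • E.resolvent β) := by
  have h1 : t • E.yosida β = (-(t * β)) • (1 : H →L[ℝ] H) + (t * β ^ 2) • E.resolvent β := by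
    rw [yosida]; module
  have h2 : Commute ((-(t * β)) • (1 : H →L[ℝ] H)) ((t * β ^ 2) • E.resolvent β) :=
    ((Commute.one_left _).smul_left _).smul_right _
  have h3 : NormedSpace.exp ((-(t * β)) • (1 : H →L[ℝ] H)) =
      Real.exp (-(t * β)) • (1 : H →L[ℝ] H) := by
    have := NormedSpace.algebraMap_exp_comm (𝕂 := ℝ) (𝔸 := H →L[ℝ] H) (-(t * β))
    rw [Algebra.algebraMap_eq_smul_one, Algebra.algebraMap_eq_smul_one] at this
    rw [← this, Real.exp_eq_exp_ℝ]
  let _ : NormedAlgebra ℚ (H →L[ℝ] H) := NormedAlgebra.restrictScalars ℚ ℝ _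
  rw [h1, NormedSpace.exp_add_of_commute h2, h3, smul_mul_assoc, one_mul]

theorem norm_resolvent_le {β : ℝ} (hβ : 0 < β) : ‖E.resolvent β‖ ≤ β⁻¹ :=
  ContinuousLinearMap.opNorm_le_bound _ (by positivity) (E.norm_resolvent_apply_le hβ)

theorem norm_exp_yosida_le [CompleteSpace H] {β : ℝ} (hβ : 0 < β) {t : ℝ} (ht : 0 ≤ t) :
    ‖NormedSpace.exp (t • E.yosida β)‖ ≤ 1 := by
  rw [exp_yosida_eq, norm_smul, Real.norm_of_nonneg (Real.exp_pos _).le]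
  have h1 : ‖(t * β ^ 2) • E.resolvent β‖ ≤ t * β := by
    rw [norm_smul, Real.norm_of_nonneg (by positivity)]
    calc t * β ^ 2 * ‖E.resolvent β‖ ≤ t * β ^ 2 * β⁻¹ := by
          gcongr; exact E.norm_resolvent_le hβ
      _ = t * β := by field_simp
  calc _ ≤ Real.exp (-(t * β)) * Real.exp (t * β) := by
        gcongr
        exact (norm_exp_le _).trans (Real.exp_le_exp.2 h1)
    _ = 1 := by rw [← Real.exp_add]; simp

theorem yosida_commute {α β : ℝ} (hα : 0 < α) (hβ : 0 < β) :
    Commute (E.yosida α) (E.yosida β) := by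
  have h := E.resolvent_commute hα hβ
  exact (((((h.smul_left α).smul_right β).sub_left (Commute.one_left _)).sub_right
    (Commute.one_right _)).smul_left α).smul_right β

theorem norm_yosida_sub_le {α β : ℝ} (hα : 0 < α) (hβ : 0 < β) (g : H) :
    ‖E.yosida α (E.resolvent 1 (E.resolvent 1 g)) - E.yosida β (E.resolvent 1 (E.resolvent 1 g))‖ ≤
      (α⁻¹ + β⁻¹) * (2 * (‖g‖ + ‖g‖)) := by
  have hR : ∀ f : H, ‖E.resolvent 1 f‖ ≤ ‖f‖ := fun f => by
    simpa using E.norm_resolvent_apply_le one_pos f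
  set k := E.resolvent 1 g - g with hk
  have hk1 : ‖k‖ ≤ ‖g‖ + ‖g‖ := (norm_sub_le _ _).trans (by gcongr; exact hR g)
  have e1 : ∀ {γ : ℝ}, 0 < γ → ∀ f : H,
      E.yosida γ (E.resolvent 1 f) = γ • E.resolvent γ (E.resolvent 1 f - f) := fun {γ} hγ f => by
    have h := E.resolvent_sub one_pos hγ f
    have : E.yosida γ (E.resolvent 1 f) =
      γ • (γ • E.resolvent γ (E.resolvent 1 f) - E.resolvent 1 f) := rfl
    rw [this, map_sub]
    congr 1
    rw [sub_smul, one_smul] at h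
    have h' : E.resolvent 1 f = E.resolvent γ f +
      (γ • E.resolvent γ (E.resolvent 1 f) - E.resolvent γ (E.resolvent 1 f)) := by
      rw [← h]; abel
    nth_rewrite 2 [h']
    abel
  have e2 : ∀ {γ : ℝ}, 0 < γ → E.yosida γ (E.resolvent 1 (E.resolvent 1 g)) =
      E.resolvent 1 k - E.resolvent γ k + E.resolvent γ (E.resolvent 1 k) := fun {γ} hγ => by
    rw [e1 hγ, ← map_sub, ← hk, E.resolvent_sub one_pos hγ]
    module
  have e3 : ∀ {γ : ℝ}, 0 < γ → ‖E.resolvent γ (E.resolvent 1 k) - E.resolvent γ k‖ ≤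
      γ⁻¹ * (2 * (‖g‖ + ‖g‖)) := fun {γ} hγ => by
    rw [← map_sub]
    refine (E.norm_resolvent_apply_le hγ _).trans ?_
    gcongr
    refine (norm_sub_le _ _).trans ?_
    have := hR k
    linarith
  have e4 : E.yosida α (E.resolvent 1 (E.resolvent 1 g)) -
      E.yosida β (E.resolvent 1 (E.resolvent 1 g)) =
      (E.resolvent α (E.resolvent 1 k) - E.resolvent α k) -
      (E.resolvent β (E.resolvent 1 k) - E.resolvent β k) := by
    rw [e2 hα, e2 hβ]; abel
  rw [e4, add_mul]
  exact (norm_sub_le _ _).trans (add_le_add (e3 hα) (e3 hβ))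

theorem exists_tendsto_exp_yosida [CompleteSpace H] {t : ℝ} (ht : 0 < t) (f : H) :
    ∃ g, Tendsto (fun β : ℝ => NormedSpace.exp (t • E.yosida β) f) atTop (𝓝 g) := by
  -- the set of good vectors
  have hcs : ∀ f : H, (∃ g, Tendsto (fun β : ℝ => NormedSpace.exp (t • E.yosida β) f) atTop (𝓝 g)) ↔
      CauchySeq (fun β : ℝ => NormedSpace.exp (t • E.yosida β) f) := fun f =>
    ⟨fun ⟨g, hg⟩ => hg.cauchySeq, fun h => cauchySeq_tendsto_of_complete h⟩
  let K : Submodule ℝ H :=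
    { carrier := {f | ∃ g, Tendsto (fun β : ℝ => NormedSpace.exp (t • E.yosida β) f) atTop (𝓝 g)}
      add_mem' := fun {a b} ⟨g, hg⟩ ⟨h, hh⟩ => ⟨g + h, by simpa using hg.add hh⟩
      zero_mem' := ⟨0, by simp⟩
      smul_mem' := fun c a ⟨g, hg⟩ => ⟨c • g, by simpa using hg.const_smul c⟩ }
  have hK1 : ∀ g : H, E.resolvent 1 (E.resolvent 1 g) ∈ K := fun g => by
    refine (hcs _).2 (Metric.cauchySeq_iff.2 fun ε hε => ?_)
    have hlim : Tendsto (fun N : ℝ => (N⁻¹ + N⁻¹) * (2 * (‖g‖ + ‖g‖)) * t) atTop (𝓝 0) := by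
      simpa using (((tendsto_inv_atTop_zero (𝕜 := ℝ)).add tendsto_inv_atTop_zero).mul_const
        (2 * (‖g‖ + ‖g‖))).mul_const t
    obtain ⟨N, hN, hN0⟩ := ((hlim.eventually (gt_mem_nhds hε)).and (eventually_gt_atTop 0)).exists
    refine ⟨N, fun α hα β hβ => ?_⟩
    have hα0 : 0 < α := lt_of_lt_of_le hN0 hα
    have hβ0 : 0 < β := lt_of_lt_of_le hN0 hβ
    rw [dist_eq_norm]
    refine lt_of_le_of_lt ((norm_exp_sub_le (E.yosida_commute hα0 hβ0)
      (fun s hs => E.norm_exp_yosida_le hα0 hs) (fun s hs => E.norm_exp_yosida_le hβ0 hs)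
      ht.le _).trans ?_) hN
    gcongr
    refine (E.norm_yosida_sub_le hα0 hβ0 g).trans ?_
    have h1 : α⁻¹ ≤ N⁻¹ := inv_anti₀ hN0 hα
    have h2 : β⁻¹ ≤ N⁻¹ := inv_anti₀ hN0 hβ
    gcongr
  have hK2 : ∀ g : H, E.resolvent 1 g = 0 → g ∈ K := fun g hg => by
    refine ⟨0, ?_⟩
    have h1 : ∀ᶠ β : ℝ in atTop,
        NormedSpace.exp (t • E.yosida β) g = Real.exp (-(t * β)) • g := by
      filter_upwards [eventually_gt_atTop 0] with β hβ
      have h2 := E.resolvent_sub one_pos hβ g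
      have h3 : E.resolvent β g = 0 := by simpa [hg] using h2
      rw [exp_yosida_eq, _root_.smul_apply, exp_smul_apply_of_apply_eq_zero]
      simp [h3]
    rw [tendsto_congr' h1]
    have h4 : Tendsto (fun β : ℝ => Real.exp (-(t * β))) atTop (𝓝 0) :=
      Real.tendsto_exp_neg_atTop_nhds_zero.comp (tendsto_id.const_mul_atTop ht)
    simpa using h4.smul_const g
  have hK3 : K.topologicalClosure = ⊤ := by
    rw [Submodule.topologicalClosure_eq_top_iff, Submodule.eq_bot_iff]
    intro x hx
    rw [Submodule.mem_orthogonal'] at hx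
    have h1 := hx _ (hK1 x)
    rw [← E.resolvent_symm one_pos, real_inner_self_eq_norm_sq] at h1
    have h2 : E.resolvent 1 x = 0 := by simpa using h1
    have h3 := hx _ (hK2 x h2)
    simpa using h3
  have hf : f ∈ closure (K : Set H) := by
    rw [← Submodule.topologicalClosure_coe, hK3]; trivial
  refine (hcs f).2 (Metric.cauchySeq_iff.2 fun ε hε => ?_)
  obtain ⟨g, hg, hfg⟩ := Metric.mem_closure_iff.1 hf (ε / 3) (by positivity)
  obtain ⟨N, hN⟩ := Metric.cauchySeq_iff.1 ((hcs g).1 hg) (ε / 3) (by positivity)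
  have hb : ∀ β : ℝ, 0 < β →
      dist (NormedSpace.exp (t • E.yosida β) f) (NormedSpace.exp (t • E.yosida β) g) < ε / 3 :=
    fun β hβ => by
      rw [dist_eq_norm, ← map_sub]
      refine lt_of_le_of_lt (ContinuousLinearMap.le_opNorm _ _) ?_
      rw [dist_eq_norm] at hfg
      have := E.norm_exp_yosida_le hβ ht.le
      calc _ ≤ 1 * ‖f - g‖ := by gcongr
        _ < _ := by rwa [one_mul]
  refine ⟨max N 1, fun α hα β hβ => ?_⟩
  have h1 := hb α (by linarith [le_max_right N 1])
  have h2 := hb β (by linarith [le_max_right N 1])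
  have h3 := hN α (le_trans (le_max_left _ _) hα) β (le_trans (le_max_left _ _) hβ)
  rw [dist_comm] at h2
  have h4 := dist_triangle4 (NormedSpace.exp (t • E.yosida α) f)
    (NormedSpace.exp (t • E.yosida α) g) (NormedSpace.exp (t • E.yosida β) g)
    (NormedSpace.exp (t • E.yosida β) f)
  linarith

/-- The limit in the definition of the semigroup exists. -/
theorem tendsto_semigroup [CompleteSpace H] {t : ℝ} (ht : 0 < t) (f : H) :
    Tendsto (fun β : ℝ => NormedSpace.exp (t • E.yosida β) f) atTop (𝓝 (E.semigroup t f)) :=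
  tendsto_nhds_limUnder (E.exists_tendsto_exp_yosida ht f)

theorem normSq_add_le (u v : E.domain) : E.normSq (u + v) ≤ 2 * E.normSq u + 2 * E.normSq v := by
  have h1 := E.nonneg (u - v)
  have h2 : 0 ≤ ‖(u : H) - v‖ ^ 2 := by positivity
  have h3 := parallelogram_law_with_norm ℝ (u : H) v
  have e1 : E.form (u + v) (u + v) + E.form (u - v) (u - v) =
      2 * E.form u u + 2 * E.form v v := by
    simp only [map_add, map_sub, LinearMap.add_apply, LinearMap.sub_apply]; ring
  simp only [normSq, Submodule.coe_add]
  nlinarith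

theorem normSq_smul (c : ℝ) (u : E.domain) : E.normSq (c • u) = c ^ 2 * E.normSq u := by
  simp only [normSq, map_smul, LinearMap.smul_apply, Submodule.coe_smul, norm_smul, smul_eq_mul,
    mul_pow, Real.norm_eq_abs, sq_abs]
  ring

theorem normSq_zero : E.normSq 0 = 0 := by simp [normSq]

theorem normSq_nonneg (u : E.domain) : 0 ≤ E.normSq u :=
  add_nonneg (E.nonneg u) (by positivity)

/-- The closure of a subspace of the form domain with respect to the graph norm. -/
def graphClosure (D : Submodule ℝ E.domain) : Submodule ℝ E.domain where
  carrier := {u | ∀ ε : ℝ, 0 < ε → ∃ v ∈ D, E.normSq (u - v) < ε}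
  add_mem' := fun {a b} ha hb ε hε => by
    obtain ⟨v, hv, hav⟩ := ha (ε / 4) (by positivity)
    obtain ⟨w, hw, hbw⟩ := hb (ε / 4) (by positivity)
    refine ⟨v + w, D.add_mem hv hw, ?_⟩
    have := E.normSq_add_le (a - v) (b - w)
    rw [add_sub_add_comm]
    linarith
  zero_mem' := fun ε hε => ⟨0, D.zero_mem, by rw [sub_zero, normSq_zero]; exact hε⟩
  smul_mem' := fun c a ha ε hε => by
    obtain ⟨v, hv, hav⟩ := ha (ε / (c ^ 2 + 1)) (by positivity)
    refine ⟨c • v, D.smul_mem c hv, ?_⟩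
    rw [← smul_sub, normSq_smul]
    rw [lt_div_iff₀ (by positivity)] at hav
    have := E.normSq_nonneg (a - v)
    nlinarith

variable {G : Type*} [NormedAddCommGroup G] [InnerProductSpace ℝ G]

/-- All `g` such that `J g` lies in the graph norm closure of `D`. -/
def pullbackDomain (D : Submodule ℝ E.domain) (J : G →ₗᵢ[ℝ] H) : Submodule ℝ G :=
  ((E.graphClosure D).map E.domain.subtype).comap J.toLinearMap

theorem exists_of_mem_pullbackDomain {D : Submodule ℝ E.domain} {J : G →ₗᵢ[ℝ] H} {g : G}
    (hg : g ∈ E.pullbackDomain D J) : ∃ w ∈ E.graphClosure D, (w : H) = J g := hg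

theorem mem_pullbackDomain {D : Submodule ℝ E.domain} {J : G →ₗᵢ[ℝ] H} {g : G}
    {w : E.domain} (hw : w ∈ E.graphClosure D) (h : (w : H) = J g) : g ∈ E.pullbackDomain D J :=
  ⟨w, hw, h⟩

/-- The map `g ↦ J g` into the form domain. -/
def pullbackIncl (D : Submodule ℝ E.domain) (J : G →ₗᵢ[ℝ] H) :
    E.pullbackDomain D J →ₗ[ℝ] E.domain :=
  (J.toLinearMap.comp (E.pullbackDomain D J).subtype).codRestrict E.domain fun u => by
    obtain ⟨w, -, hw⟩ := E.exists_of_mem_pullbackDomain u.2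
    show J u ∈ E.domain
    rw [← hw]
    exact w.2

theorem coe_pullbackIncl (D : Submodule ℝ E.domain) (J : G →ₗᵢ[ℝ] H) (u : E.pullbackDomain D J) :
    (E.pullbackIncl D J u : H) = J u := rfl

theorem pullbackIncl_mem (D : Submodule ℝ E.domain) (J : G →ₗᵢ[ℝ] H) (u : E.pullbackDomain D J) :
    E.pullbackIncl D J u ∈ E.graphClosure D := by
  obtain ⟨w, hw, hw'⟩ := E.exists_of_mem_pullbackDomain u.2
  have : E.pullbackIncl D J u = w := Subtype.ext hw'.symm
  rw [this]; exact hw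

theorem pullback_closed [CompleteSpace G] (D : Submodule ℝ E.domain) (J : G →ₗᵢ[ℝ] H)
    (u : ℕ → E.pullbackDomain D J)
    (hu : ∀ ε : ℝ, 0 < ε → ∃ N, ∀ m ≥ N, ∀ n ≥ N,
      E.normSq (E.pullbackIncl D J (u m - u n)) < ε) :
    ∃ w : E.pullbackDomain D J,
      Tendsto (fun n => E.normSq (E.pullbackIncl D J (u n - w))) atTop (𝓝 0) := by
  set ι := E.pullbackIncl D J with hι
  obtain ⟨w, hw⟩ := E.closed (fun n => ι (u n)) (fun ε hε => by
    obtain ⟨N, hN⟩ := hu ε hε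
    refine ⟨N, fun m hm n hn => ?_⟩
    have h := hN m hm n hn
    rw [map_sub] at h
    exact h)
  have hwn : Tendsto (fun n => J (u n)) atTop (𝓝 (w : H)) := by
    rw [tendsto_iff_norm_sub_tendsto_zero]
    have h1 := (Real.continuous_sqrt.tendsto 0).comp hw
    rw [Real.sqrt_zero] at h1
    refine squeeze_zero (fun _ => norm_nonneg _) (fun n => ?_) h1
    apply Real.le_sqrt_of_sq_le
    have h2 := E.nonneg (ι (u n) - w)
    have h3 : ((ι (u n) - w : E.domain) : H) = J (u n) - w := rfl
    rw [← h3]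
    show _ ≤ E.form (ι (u n) - w) (ι (u n) - w) + ‖((ι (u n) - w : E.domain) : H)‖ ^ 2
    linarith
  obtain ⟨g, hg⟩ : (w : H) ∈ Set.range J :=
    J.isometry.isClosedEmbedding.isClosed_range.mem_of_tendsto hwn
      (Eventually.of_forall fun n => ⟨u n, rfl⟩)
  have hwD : w ∈ E.graphClosure D := fun ε hε => by
    obtain ⟨n, hn⟩ := (hw.eventually (gt_mem_nhds (show 0 < ε / 4 by positivity))).exists
    obtain ⟨v, hv, hv'⟩ := E.pullbackIncl_mem D J (u n) (ε / 4) (by positivity)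
    refine ⟨v, hv, ?_⟩
    have h1 := E.normSq_add_le ((-1 : ℝ) • (ι (u n) - w)) (ι (u n) - v)
    have h2 : (-1 : ℝ) • (ι (u n) - w) + (ι (u n) - v) = w - v := by module
    rw [h2, normSq_smul] at h1
    have h3 : E.normSq (ι (u n) - w) < ε / 4 := hn
    linarith
  refine ⟨⟨g, E.mem_pullbackDomain hwD hg.symm⟩, ?_⟩
  have h4 : ι ⟨g, E.mem_pullbackDomain hwD hg.symm⟩ = w := Subtype.ext hg
  simp only [map_sub, h4]
  exact hw

/-- The restriction of the form to the graph norm closure of `D`, as a form on a Hilbert space `G`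
which is identified through the isometry `J` with a subspace of `H`. -/
def pullback [CompleteSpace G] (D : Submodule ℝ E.domain) (J : G →ₗᵢ[ℝ] H) : ClosedForm G where
  domain := E.pullbackDomain D J
  form := E.form.compl₁₂ (E.pullbackIncl D J) (E.pullbackIncl D J)
  symm := fun u v => E.symm _ _
  nonneg := fun u => E.nonneg _
  closed := fun u hu => by
    have key : ∀ v : E.pullbackDomain D J,
        E.form.compl₁₂ (E.pullbackIncl D J) (E.pullbackIncl D J) v v + ‖(v : G)‖ ^ 2 =
        E.normSq (E.pullbackIncl D J v) := fun v => by
      rw [normSq, coe_pullbackIncl, J.norm_map]; rfl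
    simp only [key] at hu ⊢
    exact E.pullback_closed D J u hu

end ClosedForm

/-- A (symmetric) Dirichlet form on `L₂(X, μ)`: a densely defined nonnegative symmetric closed form
with the Markov property `E(0 ∨ u ∧ 1) ≤ E(u)`. -/
structure DirichletForm {X : Type*} [MeasurableSpace X] (μ : Measure X)
    extends ClosedForm (Lp ℝ 2 μ) where
  dense : Dense (domain : Set (Lp ℝ 2 μ))
  markov : ∀ u : domain, ∃ w : domain,
    ((w : Lp ℝ 2 μ) : X → ℝ) =ᵐ[μ] (fun x => max 0 (min ((u : Lp ℝ 2 μ) x) 1)) ∧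
      form w w ≤ form u u

namespace DirichletForm

variable {X : Type*} [TopologicalSpace X] [MeasurableSpace X] {μ : Measure X}

/-- The natural identification of `L₂(Ω)` with a subspace of `L₂(X)`: extension by zero. -/
noncomputable def extendByZero {Ω : Set X} (hΩ : MeasurableSet Ω) :
    Lp ℝ 2 (μ.restrict Ω) →ₗᵢ[ℝ] Lp ℝ 2 μ where
  toFun u := ((memLp_indicator_iff_restrict hΩ).2 (Lp.memLp u)).toLp (Ω.indicator u)
  map_add' u v := by
    rw [← MemLp.toLp_add]
    apply MemLp.toLp_congr
    rw [← Set.indicator_add']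
    exact (ae_eq_restrict_iff_indicator_ae_eq hΩ).1 (Lp.coeFn_add u v)
  map_smul' c u := by
    rw [RingHom.id_apply, ← MemLp.toLp_const_smul]
    apply MemLp.toLp_congr
    have h : c • Ω.indicator u = Ω.indicator (c • (u : X → ℝ)) := by
      ext x; by_cases hx : x ∈ Ω <;> simp [hx]
    rw [h]
    exact (ae_eq_restrict_iff_indicator_ae_eq hΩ).1 (Lp.coeFn_smul c u)
  norm_map' u := by
    show ‖((memLp_indicator_iff_restrict hΩ).2 (Lp.memLp u)).toLp (Ω.indicator u)‖ = _
    rw [Lp.norm_toLp, eLpNorm_indicator_eq_eLpNorm_restrict hΩ, Lp.norm_def]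

/-- The support `supp u` of an element of `L₂`: the complement of the largest open set on which
`u` vanishes almost everywhere. -/
def essSupport (u : Lp ℝ 2 μ) : Set X :=
  {x | ∀ U ∈ 𝓝 x, ¬ (u =ᵐ[μ.restrict U] 0)}

theorem isClosed_essSupport (u : Lp ℝ 2 μ) : IsClosed (essSupport u) := by
  rw [← isOpen_compl_iff, isOpen_iff_mem_nhds]
  intro x hx
  simp only [essSupport, Set.mem_compl_iff, Set.mem_ofPred_eq, not_forall, not_not] at hx
  obtain ⟨U, hU, hu⟩ := hx
  filter_upwards [eventually_mem_nhds_iff.2 hU] with y hy h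
  exact h U hy hu

theorem essSupport_add_subset (u v : Lp ℝ 2 μ) :
    essSupport (u + v) ⊆ essSupport u ∪ essSupport v := by
  intro x hx
  by_contra h
  simp only [essSupport, Set.mem_union, Set.mem_ofPred_eq, not_or, not_forall, not_not] at h
  obtain ⟨⟨U, hU, hu⟩, ⟨V, hV, hv⟩⟩ := h
  refine hx (U ∩ V) (Filter.inter_mem hU hV) ?_
  filter_upwards [ae_mono (Measure.restrict_mono Set.inter_subset_left le_rfl) hu,
    ae_mono (Measure.restrict_mono Set.inter_subset_right le_rfl) hv,
    ae_restrict_of_ae (Lp.coeFn_add u v)] with y h1 h2 h3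
  rw [h3, Pi.add_apply, h1, h2]; simp

theorem essSupport_smul_subset (c : ℝ) (u : Lp ℝ 2 μ) : essSupport (c • u) ⊆ essSupport u := by
  intro x hx U hU hu
  refine hx U hU ?_
  filter_upwards [hu, ae_restrict_of_ae (Lp.coeFn_smul c u)] with y h1 h3
  rw [h3, Pi.smul_apply, h1]; simp

theorem essSupport_zero : essSupport (0 : Lp ℝ 2 μ) = ∅ := by
  refine Set.eq_empty_of_forall_notMem fun x hx => ?_
  exact hx _ Filter.univ_mem (ae_restrict_of_ae (Lp.coeFn_zero ℝ 2 μ))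


/-- The space `D_Ω` of all `u` in the form domain for which `supp u` is a compact subset of `Ω`. -/
def compactSupportDomain (E : ClosedForm (Lp ℝ 2 μ)) (Ω : Set X) : Submodule ℝ E.domain where
  carrier := {u | IsCompact (essSupport (u : Lp ℝ 2 μ)) ∧ essSupport (u : Lp ℝ 2 μ) ⊆ Ω}
  add_mem' := fun {u v} hu hv =>
    ⟨(hu.1.union hv.1).of_isClosed_subset (isClosed_essSupport _) (essSupport_add_subset _ _),
      (essSupport_add_subset _ _).trans (Set.union_subset hu.2 hv.2)⟩
  zero_mem' := by
    show IsCompact (essSupport (0 : Lp ℝ 2 μ)) ∧ essSupport (0 : Lp ℝ 2 μ) ⊆ Ω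
    rw [essSupport_zero]
    exact ⟨isCompact_empty, Set.empty_subset _⟩
  smul_mem' := fun c u hu =>
    ⟨hu.1.of_isClosed_subset (isClosed_essSupport _) (essSupport_smul_subset _ _),
      (essSupport_smul_subset _ _).trans hu.2⟩

/-- The form `E_D` on `L₂(Ω)` with Dirichlet boundary conditions on `∂Ω`: the restriction of `E`
to the graph norm closure of `D_Ω`. -/
noncomputable def dirichletRestriction (E : ClosedForm (Lp ℝ 2 μ)) {Ω : Set X}
    (hΩ : MeasurableSet Ω) : ClosedForm (Lp ℝ 2 (μ.restrict Ω)) :=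
  E.pullback (compactSupportDomain E Ω) (extendByZero hΩ)

theorem memLp_two_indicator_compactCovering [T2Space X] [SigmaCompactSpace X] [BorelSpace X]
    [IsFiniteMeasureOnCompacts μ] (g : Lp ℝ ∞ μ) (n : ℕ) :
    MemLp ((compactCovering X n).indicator g) 2 μ := by
  have hK := isCompact_compactCovering X n
  rw [memLp_indicator_iff_restrict hK.isClosed.measurableSet]
  have : IsFiniteMeasure (μ.restrict (compactCovering X n)) := ⟨by
    rw [Measure.restrict_apply_univ]; exact hK.measure_lt_top⟩
  exact ((Lp.memLp g).restrict _).mono_exponent le_top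

/-- `h = T g`, where `T` also denotes the extension to `L_∞` of a submarkovian operator on `L₂`:
`h` is the almost everywhere limit of the functions `T (𝟙_{K_n} g)`, where `K_n` is an increasing
sequence of compact sets with union `X`. -/
def IsLinftyImage [T2Space X] [SigmaCompactSpace X] [BorelSpace X] [IsFiniteMeasureOnCompacts μ]
    (T : Lp ℝ 2 μ → Lp ℝ 2 μ) (g h : Lp ℝ ∞ μ) : Prop :=
  ∀ᵐ x ∂μ, Tendsto
    (fun n : ℕ => T ((memLp_two_indicator_compactCovering g n).toLp
      ((compactCovering X n).indicator g)) x) atTop (𝓝 (h x))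

/-- The constant function `𝟙` as an element of `L_∞`. -/
noncomputable def oneLinfty (μ : Measure X) : Lp ℝ ∞ μ :=
  (memLp_top_const (1 : ℝ)).toLp (fun _ => (1 : ℝ))

/-- The semigroup is conservative: `S_t 𝟙 = 𝟙` in `L_∞` for all `t > 0`. -/
def IsConservative [T2Space X] [SigmaCompactSpace X] [BorelSpace X] [IsFiniteMeasureOnCompacts μ]
    (S : ℝ → Lp ℝ 2 μ → Lp ℝ 2 μ) : Prop :=
  ∀ t : ℝ, 0 < t → IsLinftyImage (S t) (oneLinfty μ) (oneLinfty μ)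

/-- The form is local: `E(u, v) = 0` for all `u, v` in the domain with `u v = 0`. -/
def IsLocal (E : DirichletForm μ) : Prop :=
  ∀ u v : E.domain, (∀ᵐ x ∂μ, (u : Lp ℝ 2 μ) x * (v : Lp ℝ 2 μ) x = 0) → E.form u v = 0

/-- `D(E) ∩ C_c(X)` is dense in `C₀(X)` with the supremum norm. -/
def DenseInC0 (E : DirichletForm μ) : Prop :=
  Dense {f : C₀(X, ℝ) | HasCompactSupport f ∧ ∃ u : E.domain, ((u : Lp ℝ 2 μ) : X → ℝ) =ᵐ[μ] f}

/-- The form is regular: `D(E) ∩ C_c(X)` is dense in `C₀(X)` with the supremum norm and in `D(E)`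
with the graph norm. -/
def IsRegular (E : DirichletForm μ) : Prop :=
  E.DenseInC0 ∧ ∀ u : E.domain, ∀ ε : ℝ, 0 < ε → ∃ v : E.domain,
    (∃ f : X → ℝ, Continuous f ∧ HasCompactSupport f ∧ ((v : Lp ℝ 2 μ) : X → ℝ) =ᵐ[μ] f) ∧
      E.normSq (u - v) < ε

/-- The relative capacity `cap_Ω(A)`: the infimum of `‖u‖_{D(E)} ^ 2` over all `u` in the domain
for which there is an open `V ⊇ A` with `u ≥ 1` almost everywhere on `V ∩ Ω`. -/
noncomputable def relCapacity (E : DirichletForm μ) (Ω A : Set X) : ℝ≥0∞ :=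
  ⨅ (u : E.domain) (_ : ∃ V : Set X, IsOpen V ∧ A ⊆ V ∧
    ∀ᵐ x ∂μ, x ∈ V ∩ Ω → 1 ≤ (u : Lp ℝ 2 μ) x), ENNReal.ofReal (E.normSq u)

/-- The semigroup `S^D` on `L₂(Ω)` associated with the form `E_D` with Dirichlet boundary conditions
on `∂Ω`. -/
noncomputable def dirichletSemigroup [OpensMeasurableSpace X] (E : DirichletForm μ) {Ω : Set X}
    (hΩ : IsOpen Ω) : ℝ → Lp ℝ 2 (μ.restrict Ω) → Lp ℝ 2 (μ.restrict Ω) :=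
  (dirichletRestriction E.toClosedForm hΩ.measurableSet).semigroup

/-- `S_t φ = S^D_t φ` for all `φ` in `L₂(Ω)` and `t > 0`, where `L₂(Ω)` is identified with a
subspace of `L₂(X)`. -/
def SemigroupsAgree [OpensMeasurableSpace X] (E : DirichletForm μ) {Ω : Set X}
    (hΩ : IsOpen Ω) : Prop :=
  ∀ (φ : Lp ℝ 2 (μ.restrict Ω)) (t : ℝ), 0 < t →
    E.semigroup t (extendByZero hΩ.measurableSet φ) =
      extendByZero hΩ.measurableSet (E.dirichletSemigroup hΩ t φ)

/-- `L₂(Ω)`, as a subspace of `L₂(X)`, is invariant under `S`. -/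
def IsInvariant [OpensMeasurableSpace X] (E : DirichletForm μ) {Ω : Set X}
    (hΩ : IsOpen Ω) : Prop :=
  ∀ (φ : Lp ℝ 2 (μ.restrict Ω)) (t : ℝ), 0 < t →
    E.semigroup t (extendByZero hΩ.measurableSet φ) ∈ Set.range (extendByZero hΩ.measurableSet)

end DirichletForm

/-!
Write `R_β = (β + A)⁻¹` and `R^D_β` for the resolvents of `E` and of the form `E_D` with Dirichlet
boundary conditions. The domain of `E_D` is the graph norm closure of the functions in the form
domain with compact support in `Ω`. Two facts are used throughout. Lower semicontinuity of closed
forms (`ClosedForm.exists_mem_graphClosure_of_tendsto`) says that `L₂` limits of graph norm bounded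
sequences stay in a graph norm closed subspace; with the Markov property it makes the form domain a
lattice. Locality makes `E(u⁺, u⁻)` vanish, so that `u ↦ u⁺` does not increase the graph norm, and
then lower semicontinuity shows that the domain of `E_D` is an order ideal in the form domain.

If `S^D` is conservative, the two semigroups agree. Testing with negative parts gives
`0 ≤ R^D_β f ≤ R_β f` for `0 ≤ f` in `L₂(Ω)`; since `S_t` is a limit of Poisson averages of powers
of `β R_β` (`ClosedForm.hasSum_exp_yosida`), this passes to `S^D_t f ≤ S_t f`. Also `S_t 𝟙_K ≤ 1`
for compact `K`, so the defects `S_t 𝟙_K - S^D_t 𝟙_K`, which are nonnegative and increase with `K`,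
are squeezed to zero on `Ω`. By symmetry `S_t f = S^D_t f` on `Ω`, and comparing
`‖S_t f‖ ^ 2 = ⟪S_{2t} f, f⟫` with `‖S^D_t f‖ ^ 2` shows that `S_t f` vanishes outside `Ω`.
Conversely, if the semigroups agree then `S_t` leaves the functions vanishing on `Ω` invariant, by
symmetry, so that `S^D` inherits conservation from `S`.

Agreement is connected with the capacity through the statement that multiplication by `𝟙_Ω` maps
the form domain of `E` into that of `E_D`. Agreement of the semigroups implies agreement of the
resolvents (`ClosedForm.resolvent_agree_of_semigroup_agree`, by differentiating `⟪S_t x, y⟫` at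
`t = 0`), and then `𝟙_Ω u` is the limit of the graph norm bounded functions `β R^D_β (𝟙_Ω u)`.
Conversely, if `𝟙_Ω u` is in the domain of `E_D` for all `u`, locality shows that `R^D_β f` solves
the equation which defines `R_β f`.

Given this statement, take `χ` in the form domain with `χ = 1` near a compact part of `∂Ω`, and
approximate `𝟙_Ω χ` in the graph norm by a function `v` with compact support in `Ω`. The function
`𝟙_Ω χ - v` is small and equals `1` on `Ω` near that part of `∂Ω`, and countable subadditivity gives
that `∂Ω` has capacity zero. Conversely, let the capacity vanish and let `0 ≤ u ≤ M` be in the form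
domain with compact support. If `φ` has small norm and `φ ≥ 1` on `Ω` near `∂Ω`, then
`𝟙_Ω (u - M φ)⁺` has compact support in `Ω`; it is in the form domain as it is the minimum of
`(u - M φ)⁺` and a multiple of a cutoff function. Letting the norm of `φ` tend to zero shows that
`𝟙_Ω u` is in the domain of `E_D`, and regularity extends this to all `u`.
-/

namespace ClosedForm

variable {H : Type*} [NormedAddCommGroup H] [InnerProductSpace ℝ H] (E : ClosedForm H)

/-! ### The graph norm and lower semicontinuity of closed forms -/

theorem norm_sq_le_normSq (u : E.domain) : ‖(u : H)‖ ^ 2 ≤ E.normSq u := by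
  have := E.nonneg u
  unfold normSq
  linarith

theorem normSq_neg (u : E.domain) : E.normSq (-u) = E.normSq u := by
  simpa using E.normSq_smul (-1) u

theorem normSq_sub_le (u v : E.domain) : E.normSq (u - v) ≤ 2 * E.normSq u + 2 * E.normSq v := by
  simpa [sub_eq_add_neg, normSq_neg] using E.normSq_add_le u (-v)

theorem normSq_sub_add_normSq_add (u v : E.domain) :
    E.normSq (u - v) + E.normSq (u + v) = 2 * E.normSq u + 2 * E.normSq v := by
  have h3 := parallelogram_law_with_norm ℝ (u : H) v
  have e1 : E.form (u + v) (u + v) + E.form (u - v) (u - v) =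
      2 * E.form u u + 2 * E.form v v := by
    simp only [map_add, map_sub, LinearMap.add_apply, LinearMap.sub_apply]; ring
  simp only [normSq, Submodule.coe_add, Submodule.coe_sub]
  nlinarith

theorem tendsto_coe_of_tendsto_normSq {u : ℕ → E.domain} {w : E.domain}
    (h : Tendsto (fun n => E.normSq (u n - w)) atTop (𝓝 0)) :
    Tendsto (fun n => (u n : H)) atTop (𝓝 (w : H)) := by
  rw [tendsto_iff_norm_sub_tendsto_zero]
  have h1 := (Real.continuous_sqrt.tendsto 0).comp h
  rw [Real.sqrt_zero] at h1
  exact squeeze_zero (fun _ => norm_nonneg _)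
    (fun n => Real.le_sqrt_of_sq_le (E.norm_sq_le_normSq (u n - w))) h1

theorem mem_graphClosure_of_mem {D : Submodule ℝ E.domain} {u : E.domain} (hu : u ∈ D) :
    u ∈ E.graphClosure D := fun ε hε => ⟨u, hu, by rw [sub_self, normSq_zero]; exact hε⟩

theorem mem_graphClosure_of_tendsto_normSq {D : Submodule ℝ E.domain} {u : ℕ → E.domain}
    {w : E.domain} (hu : ∀ n, u n ∈ E.graphClosure D)
    (h : Tendsto (fun n => E.normSq (u n - w)) atTop (𝓝 0)) : w ∈ E.graphClosure D := by
  intro ε hε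
  obtain ⟨n, hn⟩ := (h.eventually (gt_mem_nhds (show 0 < ε / 4 by positivity))).exists
  obtain ⟨v, hv, hv'⟩ := hu n (ε / 4) (by positivity)
  refine ⟨v, hv, ?_⟩
  have h1 := E.normSq_add_le (-(u n - w)) (u n - v)
  have h2 : -(u n - w) + (u n - v) = w - v := by abel
  rw [h2, normSq_neg] at h1
  linarith

/-- Lower semicontinuity of a closed form, in the shape of a weak compactness statement: the limit
in `H` of a graph norm bounded sequence from the graph norm closure of `D` lies in this closure. -/
theorem exists_mem_graphClosure_of_tendsto {D : Submodule ℝ E.domain} {u : ℕ → E.domain}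
    (hu : ∀ n, u n ∈ E.graphClosure D) {C : ℝ} (hC : ∀ n, E.normSq (u n) ≤ C) {h : H}
    (hlim : Tendsto (fun n => (u n : H)) atTop (𝓝 h)) :
    ∃ w ∈ E.graphClosure D, (w : H) = h := by
  -- Near-minimizers of the graph norm on shrinking balls around `h` are a Cauchy sequence.
  let ε : ℕ → ℝ := fun n => 1 / ((n : ℝ) + 1)
  have hε0 : ∀ n, 0 < ε n := fun n => Nat.one_div_pos_of_nat
  have hεa : Antitone ε := fun m n hmn => Nat.one_div_le_one_div hmn
  have hεt : Tendsto ε atTop (𝓝 0) := tendsto_one_div_add_atTop_nhds_zero_nat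
  let S : ℕ → Set ℝ := fun n =>
    E.normSq '' {v | v ∈ E.graphClosure D ∧ ‖(v : H) - h‖ ≤ ε n}
  have hne : ∀ n, ∃ r ∈ S n, r ≤ C := fun n => by
    obtain ⟨k, hk⟩ := ((tendsto_iff_norm_sub_tendsto_zero.1 hlim).eventually
      (gt_mem_nhds (hε0 n))).exists
    exact ⟨_, ⟨u k, ⟨hu k, hk.le⟩, rfl⟩, hC k⟩
  have hbdd : ∀ n, BddBelow (S n) := fun n =>
    ⟨0, by rintro _ ⟨v, -, rfl⟩; exact E.normSq_nonneg v⟩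
  let m : ℕ → ℝ := fun n => sInf (S n)
  have hmC : ∀ n, m n ≤ C := fun n => by
    obtain ⟨r, hr, hrC⟩ := hne n
    exact (csInf_le (hbdd n) hr).trans hrC
  have hmono : Monotone m := fun i j hij => by
    refine csInf_le_csInf (hbdd i) ?_ (Set.image_mono fun v hv => ⟨hv.1, hv.2.trans (hεa hij)⟩)
    obtain ⟨r, hr, -⟩ := hne j
    exact ⟨r, hr⟩
  have hmb : BddAbove (Set.range m) := ⟨C, by rintro _ ⟨n, rfl⟩; exact hmC n⟩
  have hmL := tendsto_atTop_ciSup hmono hmb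
  set L := ⨆ n, m n with hL
  have hex : ∀ n, ∃ v ∈ E.graphClosure D, ‖(v : H) - h‖ ≤ ε n ∧ E.normSq v < m n + ε n := fun n => by
    obtain ⟨r, hr, -⟩ := hne n
    obtain ⟨_, ⟨v, hv, rfl⟩, hlt⟩ := exists_lt_of_csInf_lt ⟨r, hr⟩
      (show sInf (S n) < m n + ε n from lt_add_of_pos_right _ (hε0 n))
    exact ⟨v, hv.1, hv.2, hlt⟩
  choose v hvD hvh hvm using hex
  obtain ⟨w, hw⟩ := E.closed v (fun η hη => by
    have hlim2 : Tendsto (fun n => 4 * (L - m n) + 4 * ε n) atTop (𝓝 0) := by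
      simpa using ((hmL.const_sub L).const_mul 4).add (hεt.const_mul 4)
    obtain ⟨N, hN⟩ := (hlim2.eventually (gt_mem_nhds hη)).exists
    refine ⟨N, fun i hi j hj => lt_of_le_of_lt ?_ hN⟩
    have hup : ∀ k, N ≤ k → E.normSq (v k) ≤ L + ε N := fun k hk =>
      (hvm k).le.trans (add_le_add (le_ciSup hmb k) (hεa hk))
    have hmid : m N ≤ E.normSq ((1 / 2 : ℝ) • (v i + v j)) := by
      refine csInf_le (hbdd N) ⟨_, ⟨Submodule.smul_mem _ _ (add_mem (hvD i) (hvD j)), ?_⟩, rfl⟩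
      have e : (((1 / 2 : ℝ) • (v i + v j) : E.domain) : H) - h =
          (1 / 2 : ℝ) • ((v i - h : H) + (v j - h)) := by
        rw [Submodule.coe_smul, Submodule.coe_add]; module
      rw [e, norm_smul]
      have h1 := norm_add_le ((v i : H) - h) ((v j : H) - h)
      have h2 := (hvh i).trans (hεa hi)
      have h3 := (hvh j).trans (hεa hj)
      rw [Real.norm_of_nonneg (by norm_num)]
      linarith
    rw [normSq_smul] at hmid
    have h1 := E.normSq_sub_add_normSq_add (v i) (v j)
    have h2 := hup i hi
    have h3 := hup j hj
    show E.normSq (v i - v j) ≤ _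
    linarith)
  refine ⟨w, E.mem_graphClosure_of_tendsto_normSq hvD hw, ?_⟩
  refine tendsto_nhds_unique (E.tendsto_coe_of_tendsto_normSq hw) ?_
  rw [tendsto_iff_norm_sub_tendsto_zero]
  exact squeeze_zero (fun _ => norm_nonneg _) hvh hεt

theorem exists_seq_of_mem_graphClosure {D : Submodule ℝ E.domain} {u : E.domain}
    (hu : u ∈ E.graphClosure D) : ∃ v : ℕ → E.domain, (∀ n, v n ∈ D) ∧
      (∀ n, E.normSq (v n) ≤ 2 * E.normSq u + 2) ∧
      Tendsto (fun n => (v n : H)) atTop (𝓝 (u : H)) := by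
  choose v hv hvn using fun n : ℕ => hu (1 / ((n : ℝ) + 1)) Nat.one_div_pos_of_nat
  refine ⟨v, hv, fun n => ?_, E.tendsto_coe_of_tendsto_normSq ?_⟩
  · have h1 := E.normSq_sub_le u (u - v n)
    rw [sub_sub_cancel] at h1
    have h2 : 1 / ((n : ℝ) + 1) ≤ 1 := by
      simpa using Nat.one_div_le_one_div (α := ℝ) (Nat.zero_le n)
    linarith [hvn n]
  · refine squeeze_zero (fun n => E.normSq_nonneg _) (fun n => ?_)
      (tendsto_one_div_add_atTop_nhds_zero_nat (𝕜 := ℝ))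
    rw [← neg_sub, normSq_neg]
    exact (hvn n).le

/-! ### Series in the form domain -/

/-- The weights `4 ^ (n + 1)` absorb the factors `2` which come from `normSq_add_le`. -/
theorem normSq_sum_le {ε : ℝ} {f : ℕ → E.domain}
    (hf : ∀ n, E.normSq (f n) ≤ ε / 4 ^ (n + 1)) (n m : ℕ) :
    E.normSq (∑ i ∈ Finset.range n, f (m + i)) ≤ ε / 4 ^ m := by
  have hε : 0 ≤ ε := by
    have h1 := (E.normSq_nonneg _).trans (hf 0)
    rw [le_div_iff₀ (by positivity), zero_mul] at h1
    exact h1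
  induction n generalizing m with
  | zero =>
    rw [Finset.sum_range_zero, normSq_zero]
    positivity
  | succ n ih =>
    rw [Finset.sum_range_succ']
    have e : ∀ i, f (m + (i + 1)) = f (m + 1 + i) := fun i => by congr 1; ring
    simp only [e, add_zero]
    have h1 := E.normSq_add_le (∑ i ∈ Finset.range n, f (m + 1 + i)) (f m)
    have h2 := ih (m + 1)
    have h3 := hf m
    have h4 : ε / 4 ^ (m + 1) = ε / 4 ^ m / 4 := by rw [pow_succ]; field_simp
    have h5 : 0 ≤ ε / 4 ^ m := by positivity
    linarith

/-- A rapidly convergent series in the form domain converges for the graph norm. -/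
theorem exists_sum {ε : ℝ} {f : ℕ → E.domain} (hf : ∀ n, E.normSq (f n) ≤ ε / 4 ^ (n + 1)) :
    ∃ w : E.domain, Tendsto (fun n => ((∑ i ∈ Finset.range n, f i : E.domain) : H)) atTop
      (𝓝 (w : H)) ∧ E.normSq w ≤ 2 * ε := by
  set s : ℕ → E.domain := fun n => ∑ i ∈ Finset.range n, f i with hs
  have hdiff : ∀ N n, N ≤ n → E.normSq (s n - s N) ≤ ε / 4 ^ N := fun N n hn => by
    obtain ⟨k, rfl⟩ := Nat.exists_eq_add_of_le hn
    have e : s (N + k) - s N = ∑ i ∈ Finset.range k, f (N + i) := by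
      simp only [hs, Finset.sum_range_add, add_sub_cancel_left]
    rw [e]
    exact E.normSq_sum_le hf k N
  have hlim : Tendsto (fun N : ℕ => 4 * (ε / 4 ^ N)) atTop (𝓝 0) := by
    simpa using ((tendsto_const_nhds (x := ε)).div_atTop
      (tendsto_pow_atTop_atTop_of_one_lt (show (1 : ℝ) < 4 by norm_num))).const_mul 4
  obtain ⟨w, hw⟩ := E.closed s (fun η hη => by
    obtain ⟨N, hN⟩ := (hlim.eventually (gt_mem_nhds hη)).exists
    refine ⟨N, fun i hi j hj => lt_of_le_of_lt ?_ hN⟩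
    have h1 := E.normSq_sub_le (s i - s N) (s j - s N)
    rw [sub_sub_sub_cancel_right] at h1
    have h2 := hdiff N i hi
    have h3 := hdiff N j hj
    show E.normSq (s i - s j) ≤ _
    linarith)
  refine ⟨w, E.tendsto_coe_of_tendsto_normSq hw, ?_⟩
  have h1 : Tendsto (fun n => 2 * ε + 2 * E.normSq (s n - w)) atTop (𝓝 (2 * ε + 2 * 0)) :=
    (Tendsto.const_mul 2 hw).const_add _
  rw [mul_zero, add_zero] at h1
  refine ge_of_tendsto' h1 fun n => ?_
  have h2 := E.normSq_sub_le (s n) (s n - w)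
  rw [sub_sub_cancel] at h2
  have h3 := hdiff 0 n (Nat.zero_le n)
  simp only [hs, Finset.sum_range_zero, sub_zero, pow_zero, div_one] at h3
  linarith

/-! ### Resolvents, and semigroups as limits of convex combinations of their powers -/

/-- The defining equation of the resolvent of a restricted form, read in the larger space. -/
theorem pullback_resolvent_spec {G : Type*} [NormedAddCommGroup G] [InnerProductSpace ℝ G]
    [CompleteSpace G] (D : Submodule ℝ E.domain) (J : G →ₗᵢ[ℝ] H) {β : ℝ} (hβ : 0 < β) (f : G) :
    ∃ w ∈ E.graphClosure D, (w : H) = J ((E.pullback D J).resolvent β f) ∧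
      ∀ v ∈ E.graphClosure D, (v : H) ∈ Set.range J →
        E.form w v + β * inner ℝ (w : H) v = inner ℝ (J f) (v : H) := by
  refine ⟨E.pullbackIncl D J ((E.pullback D J).resolventFun hβ f), E.pullbackIncl_mem _ _ _, ?_, ?_⟩
  · rw [ClosedForm.resolvent_apply _ hβ]
    rfl
  · rintro v hv ⟨g, hg⟩
    have hgv : E.pullbackIncl D J ⟨g, E.mem_pullbackDomain hv hg.symm⟩ = v := Subtype.ext hg
    have h := (E.pullback D J).resolventFun_spec hβ f ⟨g, E.mem_pullbackDomain hv hg.symm⟩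
    rw [← hg, ← hgv]
    show _ + β * inner ℝ (J _) (J _) = _
    rw [J.inner_map_map, J.inner_map_map]
    exact h

/-- The Poisson weights. -/
theorem hasSum_poisson (a : ℝ) :
    HasSum (fun n : ℕ => Real.exp (-a) * (a ^ n / n.factorial)) 1 := by
  have h := (NormedSpace.expSeries_div_hasSum_exp (𝔸 := ℝ) a).mul_left (Real.exp (-a))
  rwa [← Real.exp_eq_exp_ℝ, ← Real.exp_add, neg_add_cancel, Real.exp_zero] at h

theorem hasSum_exp_yosida [CompleteSpace H] (β t : ℝ) (f : H) :
    HasSum (fun n : ℕ => (Real.exp (-(t * β)) * ((t * β) ^ n / n.factorial)) •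
      ((β • E.resolvent β) ^ n) f) (NormedSpace.exp (t • E.yosida β) f) := by
  have h := NormedSpace.exp_series_hasSum_exp' (𝕂 := ℝ) ((t * β ^ 2) • E.resolvent β)
  have h1 := (h.mapL (ContinuousLinearMap.apply ℝ H f)).const_smul (Real.exp (-(t * β)))
  rw [exp_yosida_eq]
  refine Eq.subst (motive := fun F => HasSum F _) (funext fun n => ?_) h1
  have e : (t * β ^ 2) • E.resolvent β = (t * β) • (β • E.resolvent β) := by
    rw [smul_smul]; ring_nf
  rw [e, smul_pow (t * β)]
  simp only [ContinuousLinearMap.apply_apply, _root_.smul_apply, smul_smul]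
  congr 1
  ring

/-- A closed convex set contains infinite convex combinations of its elements. -/
theorem _root_.Convex.mem_of_hasSum {V : Type*} [NormedAddCommGroup V] [NormedSpace ℝ V]
    {C : Set V} (hconv : Convex ℝ C) (hclosed : IsClosed C) {w : ℕ → ℝ} (hw0 : ∀ n, 0 ≤ w n)
    (hw : HasSum w 1) {x : ℕ → V} (hx : ∀ n, x n ∈ C) {s : V}
    (hs : HasSum (fun n => w n • x n) s) : s ∈ C := by
  have h1 := hw.tendsto_sum_nat
  have h2 := (h1.inv₀ one_ne_zero).smul hs.tendsto_sum_nat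
  rw [inv_one, one_smul] at h2
  refine hclosed.mem_of_tendsto h2 ?_
  filter_upwards [h1.eventually (lt_mem_nhds one_pos)] with N hN
  exact hconv.centerMass_mem (fun i _ => hw0 i) hN (fun i _ => hx i)

/-- A closed convex set which is invariant under `β (β + A)⁻¹` for all `β > 0` is invariant under
the semigroup. -/
theorem semigroup_mem_of_resolvent_mem [CompleteSpace H] {C : Set H} (hconv : Convex ℝ C)
    (hclosed : IsClosed C) (hC : ∀ β : ℝ, 0 < β → ∀ f ∈ C, β • E.resolvent β f ∈ C)
    {t : ℝ} (ht : 0 < t) {f : H} (hf : f ∈ C) : E.semigroup t f ∈ C := by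
  refine hclosed.mem_of_tendsto (E.tendsto_semigroup ht f) ?_
  filter_upwards [eventually_gt_atTop 0] with β hβ
  refine hconv.mem_of_hasSum hclosed (fun n => ?_) (hasSum_poisson (t * β)) (fun n => ?_)
    (E.hasSum_exp_yosida β t f)
  · positivity
  · induction n with
    | zero => simpa using hf
    | succ n ih => rw [pow_succ']; exact hC β hβ _ ih

theorem semigroup_sub [CompleteSpace H] {t : ℝ} (ht : 0 < t) (f g : H) :
    E.semigroup t (f - g) = E.semigroup t f - E.semigroup t g := by
  refine tendsto_nhds_unique (E.tendsto_semigroup ht _) ?_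
  simpa only [map_sub] using (E.tendsto_semigroup ht f).sub (E.tendsto_semigroup ht g)

theorem inner_exp_yosida [CompleteSpace H] {β : ℝ} (hβ : 0 < β) (t : ℝ) (f g : H) :
    inner ℝ (NormedSpace.exp (t • E.yosida β) f) g =
      inner ℝ f (NormedSpace.exp (t • E.yosida β) g) := by
  have h1 : ∀ n : ℕ, ∀ f g : H, inner ℝ (((β • E.resolvent β) ^ n) f) g =
      inner ℝ f (((β • E.resolvent β) ^ n) g) := by
    intro n
    induction n with
    | zero => intro f g; simp
    | succ n ih =>
      intro f g
      nth_rewrite 1 [pow_succ]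
      rw [pow_succ', mul_apply_eq_comp, mul_apply_eq_comp, ih,
        _root_.smul_apply, _root_.smul_apply, inner_smul_left, inner_smul_right,
        E.resolvent_symm hβ]
      rfl
  have h2 := (E.hasSum_exp_yosida β t f).mapL (innerSL ℝ g)
  have h3 := (E.hasSum_exp_yosida β t g).mapL (innerSL ℝ f)
  simp only [innerSL_apply_apply, inner_smul_right] at h2 h3
  rw [real_inner_comm]
  refine h2.unique ?_
  convert h3 using 3 with n
  rw [real_inner_comm, h1]

theorem semigroup_symm [CompleteSpace H] {t : ℝ} (ht : 0 < t) (f g : H) :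
    inner ℝ (E.semigroup t f) g = inner ℝ f (E.semigroup t g) := by
  have h1 := (E.tendsto_semigroup ht f).inner (𝕜 := ℝ) (tendsto_const_nhds (x := g))
  have h2 := (tendsto_const_nhds (x := f)).inner (𝕜 := ℝ) (E.tendsto_semigroup ht g)
  refine tendsto_nhds_unique_of_eventuallyEq h1 h2 ?_
  filter_upwards [eventually_gt_atTop 0] with β hβ using E.inner_exp_yosida hβ t f g

theorem semigroup_semigroup [CompleteSpace H] {s t : ℝ} (hs : 0 < s) (ht : 0 < t) (f : H) :
    E.semigroup s (E.semigroup t f) = E.semigroup (s + t) f := by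
  have h1 := E.tendsto_semigroup (add_pos hs ht) f
  have h2 := E.tendsto_semigroup hs (E.semigroup t f)
  have h3 := tendsto_iff_norm_sub_tendsto_zero.1 (E.tendsto_semigroup ht f)
  have h4 : Tendsto (fun β => NormedSpace.exp ((s + t) • E.yosida β) f -
      NormedSpace.exp (s • E.yosida β) (E.semigroup t f)) atTop (𝓝 0) := by
    refine squeeze_zero_norm' ?_ h3
    filter_upwards [eventually_gt_atTop 0] with β hβ
    let _ : NormedAlgebra ℚ (H →L[ℝ] H) := NormedAlgebra.restrictScalars ℚ ℝ _
    rw [add_smul, NormedSpace.exp_add_of_commute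
      (((Commute.refl (E.yosida β)).smul_left s).smul_right t), mul_apply_eq_comp,
      ← map_sub]
    refine (ContinuousLinearMap.le_opNorm _ _).trans ?_
    exact mul_le_of_le_one_left (norm_nonneg _) (E.norm_exp_yosida_le hβ hs.le)
  have h5 := h1.sub h2
  exact (sub_eq_zero.1 (tendsto_nhds_unique h5 h4)).symm

/-! ### The semigroup determines the resolvent -/

theorem norm_exp_sub_one_sub_le [CompleteSpace H] {A : H →L[ℝ] H}
    (hA : ∀ s : ℝ, 0 ≤ s → ‖NormedSpace.exp (s • A)‖ ≤ 1) {t : ℝ} (ht : 0 ≤ t) (f : H) :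
    ‖NormedSpace.exp (t • A) f - f - t • A f‖ ≤ ‖A (A f)‖ * t * t := by
  have h0 : ∀ s : ℝ, 0 ≤ s → ∀ g : H, ‖NormedSpace.exp (s • A) g - g‖ ≤ ‖A g‖ * s := by
    intro s hs g
    have h := norm_exp_sub_le (Commute.zero_right A) hA (fun s _ => by
      rw [smul_zero, NormedSpace.exp_zero]; exact ContinuousLinearMap.norm_id_le) hs g
    simpa using h
  have hd : ∀ s : ℝ, HasDerivAt (fun s : ℝ => NormedSpace.exp (s • A) f - f - s • A f)
      (NormedSpace.exp (s • A) (A f) - A f) s := fun s => by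
    have h1 := (hasDerivAt_exp_smul_const (𝕂 := ℝ) A s).clm_apply (hasDerivAt_const s f)
    have h2 := (h1.sub_const f).sub ((hasDerivAt_id s).smul_const (A f))
    rw [map_zero, add_zero, one_smul] at h2
    exact h2
  have hb := norm_image_sub_le_of_norm_deriv_le_segment' (a := 0) (b := t) (C := ‖A (A f)‖ * t)
    (fun s _ => (hd s).hasDerivWithinAt) (fun s hs => by
      refine (h0 s hs.1 _).trans ?_
      have := hs.2.le
      gcongr) t ⟨ht, le_rfl⟩
  simpa using hb

theorem yosida_resolvent {β γ : ℝ} (hβ : 0 < β) (hγ : 0 < γ) (f : H) :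
    E.yosida β (E.resolvent γ f) = β • E.resolvent β (γ • E.resolvent γ f - f) := by
  have h := E.resolvent_sub hγ hβ f
  have e : E.yosida β (E.resolvent γ f) =
      β • (β • E.resolvent β (E.resolvent γ f) - E.resolvent γ f) := rfl
  rw [e, map_sub, map_smul]
  congr 1
  rw [sub_smul, sub_eq_iff_eq_add] at h
  nth_rewrite 2 [h]
  abel

/-- On the range of `(γ + A)⁻²` the semigroup has the expansion `S_t x = x - t A x + O(t ^ 2)`. -/
theorem norm_semigroup_resolvent_sub_le [CompleteSpace H] {γ : ℝ} (hγ : 0 < γ) (g : H) :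
    ∃ C : ℝ, ∀ t : ℝ, 0 < t →
      ‖E.semigroup t (E.resolvent γ (E.resolvent γ g)) - E.resolvent γ (E.resolvent γ g) -
        t • E.resolvent γ (γ • E.resolvent γ g - g)‖ ≤ C * t * t := by
  set R := E.resolvent γ with hR
  set q := γ • R g - g with hq
  set q₂ := γ • R q - q with hq2
  refine ⟨‖q₂‖, fun t ht => ?_⟩
  have hRg : γ • R (R g) - R g = R q := by rw [hq, map_sub, map_smul]
  clear_value q
  have hn : ∀ {β : ℝ}, 0 < β → ∀ x : H, ‖β • E.resolvent β x‖ ≤ ‖x‖ := fun {β} hβ x => by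
    rw [norm_smul, Real.norm_of_nonneg hβ.le]
    calc β * ‖E.resolvent β x‖ ≤ β * (β⁻¹ * ‖x‖) := by
          gcongr; exact E.norm_resolvent_apply_le hβ x
      _ = ‖x‖ := by field_simp
  have e1 : ∀ {β : ℝ}, 0 < β → E.yosida β (R (R g)) = β • E.resolvent β (R q) := fun {β} hβ => by
    rw [hR, E.yosida_resolvent hβ hγ, ← hR, hRg]
  have e2 : ∀ {β : ℝ}, 0 < β → ‖E.yosida β (E.yosida β (R (R g)))‖ ≤ ‖q₂‖ := fun {β} hβ => by
    rw [e1 hβ, map_smul]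
    have hc : E.yosida β (E.resolvent β (R q)) = E.resolvent β (E.yosida β (R q)) := by
      simp only [yosida, _root_.smul_apply, _root_.sub_apply, one_apply_eq_self,
        map_smul, map_sub]
    rw [hc, hR, E.yosida_resolvent hβ hγ, ← hR, ← hq2]
    exact (hn hβ _).trans (hn hβ _)
  have e3 : Tendsto (fun β : ℝ => β • E.resolvent β (R q)) atTop (𝓝 (R q)) := by
    rw [tendsto_iff_norm_sub_tendsto_zero]
    have hl : Tendsto (fun β : ℝ => β⁻¹ * ‖q₂‖) atTop (𝓝 0) := by
      simpa using (tendsto_inv_atTop_zero (𝕜 := ℝ)).mul_const ‖q₂‖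
    refine squeeze_zero' (Eventually.of_forall fun _ => norm_nonneg _) ?_ hl
    filter_upwards [eventually_gt_atTop 0] with β hβ
    have h := E.resolvent_sub hγ hβ q
    have : β • E.resolvent β (R q) - R q = E.resolvent β q₂ := by
      rw [hq2, map_sub, map_smul]
      rw [← hR, sub_smul, sub_eq_iff_eq_add] at h
      nth_rewrite 2 [h]
      abel
    rw [this]
    exact E.norm_resolvent_apply_le hβ _
  have h1 := (((E.tendsto_semigroup ht (R (R g))).sub_const (R (R g))).sub (e3.const_smul t)).norm
  refine le_of_tendsto h1 ?_
  filter_upwards [eventually_gt_atTop 0] with β hβ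
  have h2 := norm_exp_sub_one_sub_le (fun s hs => E.norm_exp_yosida_le hβ hs) ht.le (R (R g))
  rw [e1 hβ] at h2
  refine h2.trans ?_
  have := e2 hβ
  rw [e1 hβ] at this
  gcongr

theorem eq_zero_of_resolvent_eq_zero (hd : Dense (E.domain : Set H)) {γ : ℝ} (hγ : 0 < γ) {x : H}
    (hx : E.resolvent γ x = 0) : x = 0 := by
  have h0 : E.resolventFun hγ x = 0 := Subtype.ext (by rw [← E.resolvent_apply hγ, hx]; rfl)
  refine hd.eq_zero_of_inner_left (𝕜 := ℝ) fun v hv => ?_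
  have h := E.resolventFun_spec hγ x ⟨v, hv⟩
  rw [h0] at h
  simpa using h.symm

theorem semigroup_eq_zero_of_resolvent_eq_zero [CompleteSpace H] {γ : ℝ} (hγ : 0 < γ) {x : H}
    (hx : E.resolvent γ x = 0) {t : ℝ} (ht : 0 < t) : E.semigroup t x = 0 := by
  refine tendsto_nhds_unique (E.tendsto_semigroup ht x) ?_
  have h1 : ∀ᶠ β : ℝ in atTop,
      Real.exp (-(t * β)) • x = NormedSpace.exp (t • E.yosida β) x := by
    filter_upwards [eventually_gt_atTop 0] with β hβ
    have h2 := E.resolvent_sub hγ hβ x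
    have h3 : E.resolvent β x = 0 := by simpa [hx] using h2
    rw [exp_yosida_eq, _root_.smul_apply, exp_smul_apply_of_apply_eq_zero]
    simp [h3]
  refine Tendsto.congr' h1 ?_
  have h4 : Tendsto (fun β : ℝ => Real.exp (-(t * β))) atTop (𝓝 0) :=
    Real.tendsto_exp_neg_atTop_nhds_zero.comp (tendsto_id.const_mul_atTop ht)
  simpa using h4.smul_const x

theorem eq_zero_of_forall_abs_le_mul {d C : ℝ} (h : ∀ t : ℝ, 0 < t → |d| ≤ C * t) : d = 0 := by
  have h1 : Tendsto (fun t : ℝ => C * t) (𝓝[>] 0) (𝓝 (C * 0)) :=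
    (tendsto_id.const_mul C).mono_left nhdsWithin_le_nhds
  rw [mul_zero] at h1
  exact abs_eq_zero.1 (le_antisymm (ge_of_tendsto h1 (eventually_mem_nhdsWithin.mono h))
    (abs_nonneg d))

variable {G : Type*} [NormedAddCommGroup G] [InnerProductSpace ℝ G] [CompleteSpace G]
  [CompleteSpace H]

/-- If the semigroup of a densely defined form restricts to the semigroup of another form on a
subspace, then the same is true of the resolvents. Density of the domain of the second form is a
consequence, not a hypothesis. -/
theorem resolvent_agree_of_semigroup_agree (F : ClosedForm G) (J : G →ₗᵢ[ℝ] H)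
    (hd : Dense (E.domain : Set H))
    (h : ∀ (g : G) (t : ℝ), 0 < t → E.semigroup t (J g) = J (F.semigroup t g))
    {γ : ℝ} (hγ : 0 < γ) (g : G) : E.resolvent γ (J g) = J (F.resolvent γ g) := by
  have hinj : ∀ x : H, (∀ k, inner ℝ x (E.resolvent γ k) = 0) → x = 0 := fun x hx => by
    apply E.eq_zero_of_resolvent_eq_zero hd hγ
    rw [← inner_self_eq_zero (𝕜 := ℝ), E.resolvent_symm hγ, hx]
  have hFinj : ∀ x : G, F.resolvent γ x = 0 → x = 0 := fun x hx => by
    suffices hJ : J x = 0 from J.injective (by rw [hJ, map_zero])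
    refine E.eq_zero_of_resolvent_eq_zero hd hγ (hinj _ fun k => ?_)
    rw [E.resolvent_symm hγ]
    obtain ⟨C, hC⟩ := E.norm_semigroup_resolvent_sub_le hγ k
    set y := E.resolvent γ (E.resolvent γ k)
    set y' := E.resolvent γ (γ • E.resolvent γ k - k)
    have hS : ∀ t : ℝ, 0 < t → inner ℝ (J x) (E.semigroup t y) = 0 := fun t ht => by
      rw [← E.semigroup_symm ht, h x t ht, F.semigroup_eq_zero_of_resolvent_eq_zero hγ hx ht,
        map_zero, inner_zero_left]
    have hlim : Tendsto (fun t : ℝ => ‖J x‖ * (C * t * t) + |t * inner ℝ (J x) y'|) (𝓝[>] 0)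
        (𝓝 (‖J x‖ * (C * 0 * 0) + |0 * inner ℝ (J x) y'|)) := by
      refine (Continuous.tendsto ?_ 0).mono_left nhdsWithin_le_nhds
      fun_prop
    simp only [mul_zero, zero_mul, abs_zero, add_zero] at hlim
    refine abs_eq_zero.1 (le_antisymm (ge_of_tendsto hlim ?_) (abs_nonneg _))
    filter_upwards [self_mem_nhdsWithin] with t ht
    have h1 := (abs_real_inner_le_norm (J x) _).trans
      (mul_le_mul_of_nonneg_left (hC t ht) (norm_nonneg (J x)))
    rw [inner_sub_right, inner_sub_right, hS t ht, inner_smul_right] at h1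
    have h2 := abs_sub_abs_le_abs_sub (inner ℝ (J x) y) (-(t * inner ℝ (J x) y'))
    rw [abs_neg] at h2
    have h3 : |inner ℝ (J x) y - -(t * inner ℝ (J x) y')| =
        |0 - inner ℝ (J x) y - t * inner ℝ (J x) y'| := by
      rw [← abs_neg]; congr 1; ring
    linarith
  have key : ∀ g : G, E.resolvent γ (J (F.resolvent γ g)) =
      J (F.resolvent γ (F.resolvent γ g)) := fun g => by
    rw [← sub_eq_zero]
    refine hinj _ fun k => ?_
    obtain ⟨C, hC⟩ := E.norm_semigroup_resolvent_sub_le hγ k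
    obtain ⟨B, hB⟩ := F.norm_semigroup_resolvent_sub_le hγ g
    set y := E.resolvent γ (E.resolvent γ k) with hy
    set y' := E.resolvent γ (γ • E.resolvent γ k - k) with hy'
    set x := F.resolvent γ (F.resolvent γ g) with hx
    set x' := F.resolvent γ (γ • F.resolvent γ g - g) with hx'
    have e1 : y' = γ • y - E.resolvent γ k := by rw [hy', map_sub, map_smul]
    have e2 : x' = γ • x - F.resolvent γ g := by rw [hx', map_sub, map_smul]
    -- Both sides are the derivative at `t = 0` of `⟪S_t (J x), y⟫`.
    have hder : inner ℝ (J x) y' - inner ℝ (J x') y = 0 := by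
      refine eq_zero_of_forall_abs_le_mul (C := ‖J x‖ * C + B * ‖y‖) fun t ht => ?_
      have h1 := (abs_real_inner_le_norm (J x) _).trans
        (mul_le_mul_of_nonneg_left (hC t ht) (norm_nonneg (J x)))
      have h2 : ‖J (F.semigroup t x - x - t • x')‖ ≤ B * t * t := by
        rw [J.norm_map]; exact hB t ht
      have h3 := (abs_real_inner_le_norm _ y).trans
        (mul_le_mul_of_nonneg_right h2 (norm_nonneg y))
      rw [inner_sub_right, inner_sub_right, inner_smul_right] at h1
      rw [map_sub, map_sub, map_smul, inner_sub_left, inner_sub_left, inner_smul_left, ← h x t ht,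
        E.semigroup_symm ht] at h3
      simp only [conj_trivial] at h3
      have h4 : t * |inner ℝ (J x) y' - inner ℝ (J x') y| ≤ t * ((‖J x‖ * C + B * ‖y‖) * t) := by
        rw [← abs_of_pos ht, ← abs_mul, abs_of_pos ht]
        rw [abs_le] at h1 h3 ⊢
        constructor <;> linarith
      exact le_of_mul_le_mul_left h4 ht
    rw [e1, e2, map_sub, map_smul, inner_sub_right, inner_sub_left, inner_smul_left,
      inner_smul_right] at hder
    simp only [conj_trivial] at hder
    rw [inner_sub_left, E.resolvent_symm hγ]
    linarith
  -- The defect vanishes on the range of the resolvent of `F`, so its adjoint vanishes.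
  rw [← sub_eq_zero, ← inner_self_eq_zero (𝕜 := ℝ)]
  generalize hp : E.resolvent γ (J g) - J (F.resolvent γ g) = p
  set Ja := ContinuousLinearMap.adjoint J.toContinuousLinearMap with hJa
  have hadj : ∀ (a : G) (b : H), inner ℝ (J a) b = inner ℝ a (Ja b) := fun a b =>
    (ContinuousLinearMap.adjoint_inner_right J.toContinuousLinearMap a b).symm
  have hT : ∀ a : G, inner ℝ (E.resolvent γ (J a) - J (F.resolvent γ a)) p =
      inner ℝ a (Ja (E.resolvent γ p) - F.resolvent γ (Ja p)) := fun a => by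
    rw [inner_sub_left, inner_sub_right, E.resolvent_symm hγ, hadj, hadj, F.resolvent_symm hγ]
  have hz : Ja (E.resolvent γ p) - F.resolvent γ (Ja p) = 0 := by
    refine hFinj _ ?_
    rw [← inner_self_eq_zero (𝕜 := ℝ), F.resolvent_symm hγ, real_inner_comm, F.resolvent_symm hγ,
      ← F.resolvent_symm hγ, ← hT, key, sub_self, inner_zero_left]
  have := hT g
  rwa [hz, inner_zero_right, hp] at this

theorem semigroup_agree_of_resolvent_agree (F : ClosedForm G) (J : G →ₗᵢ[ℝ] H)
    (h : ∀ (γ : ℝ) (g : G), 0 < γ → E.resolvent γ (J g) = J (F.resolvent γ g))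
    {t : ℝ} (ht : 0 < t) (g : G) : E.semigroup t (J g) = J (F.semigroup t g) := by
  refine tendsto_nhds_unique (E.tendsto_semigroup ht (J g)) ?_
  refine Tendsto.congr' ?_ ((J.continuous.tendsto _).comp (F.tendsto_semigroup ht g))
  filter_upwards [eventually_gt_atTop 0] with β hβ
  have hpow : ∀ n : ℕ, ((β • E.resolvent β) ^ n) (J g) = J (((β • F.resolvent β) ^ n) g) := by
    intro n
    induction n with
    | zero => simp
    | succ n ih =>
      rw [pow_succ', pow_succ', mul_apply_eq_comp, ih, _root_.smul_apply,
        mul_apply_eq_comp, _root_.smul_apply, h β _ hβ, map_smul]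
  have h1 := (F.hasSum_exp_yosida β t g).mapL J.toContinuousLinearMap
  refine h1.unique ?_
  convert E.hasSum_exp_yosida β t (J g) using 2 with n
  rw [hpow, map_smul]
  rfl

end ClosedForm

/-! ### Lattice operations on real `L₂` spaces -/

namespace DirichletForm

section Lattice

variable {X : Type*} [MeasurableSpace X] {μ : Measure X}

theorem coeFn_pos (u : Lp ℝ 2 μ) : (u⁺ : Lp ℝ 2 μ) =ᵐ[μ] fun x => max (u x) 0 := by
  filter_upwards [Lp.coeFn_sup u 0, Lp.coeFn_zero ℝ 2 μ] with x h1 h2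
  rw [posPart_def, h1, Pi.sup_apply, h2, Pi.zero_apply]

theorem coeFn_neg_part (u : Lp ℝ 2 μ) : (u⁻ : Lp ℝ 2 μ) =ᵐ[μ] fun x => max (-u x) 0 := by
  filter_upwards [Lp.coeFn_sup (-u) 0, Lp.coeFn_zero ℝ 2 μ, Lp.coeFn_neg u] with x h1 h2 h3
  rw [negPart_def, h1, Pi.sup_apply, h2, Pi.zero_apply, h3, Pi.neg_apply]

theorem pos_mul_neg_eq_zero (u : Lp ℝ 2 μ) :
    ∀ᵐ x ∂μ, (u⁺ : Lp ℝ 2 μ) x * (u⁻ : Lp ℝ 2 μ) x = 0 := by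
  filter_upwards [coeFn_pos u, coeFn_neg_part u] with x h1 h2
  rw [h1, h2]
  rcases le_total (u x) 0 with h | h
  · rw [max_eq_right h, zero_mul]
  · rw [max_eq_right (neg_nonpos.2 h), mul_zero]

theorem inner_eq_integral (u v : Lp ℝ 2 μ) : inner ℝ u v = ∫ x, u x * v x ∂μ := by
  rw [L2.inner_def]
  exact integral_congr_ae (Eventually.of_forall fun x => by simp [mul_comm])

theorem integrable_mul (u v : Lp ℝ 2 μ) : Integrable (fun x => u x * v x) μ :=
  (Lp.memLp u).integrable_mul (Lp.memLp v)

theorem inner_eq_zero_of_mul_eq_zero {u v : Lp ℝ 2 μ} (h : ∀ᵐ x ∂μ, u x * v x = 0) :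
    inner ℝ u v = 0 := by
  rw [inner_eq_integral]
  exact integral_eq_zero_of_ae h

theorem inner_nonneg_of_nonneg {u v : Lp ℝ 2 μ} (hu : 0 ≤ u) (hv : 0 ≤ v) : 0 ≤ inner ℝ u v := by
  rw [inner_eq_integral]
  refine integral_nonneg_of_ae ?_
  filter_upwards [(Lp.coeFn_nonneg u).2 hu, (Lp.coeFn_nonneg v).2 hv] with x h1 h2
  exact mul_nonneg h1 h2

theorem mul_eq_zero_of_inner_eq_zero {u v : Lp ℝ 2 μ} (hu : 0 ≤ u) (hv : 0 ≤ v)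
    (h : inner ℝ u v = 0) : ∀ᵐ x ∂μ, u x * v x = 0 := by
  rw [inner_eq_integral] at h
  refine (integral_eq_zero_iff_of_nonneg_ae ?_ (integrable_mul u v)).1 h
  filter_upwards [(Lp.coeFn_nonneg u).2 hu, (Lp.coeFn_nonneg v).2 hv] with x h1 h2
  exact mul_nonneg h1 h2

theorem smul_nonneg_Lp {c : ℝ} (hc : 0 ≤ c) {u : Lp ℝ 2 μ} (hu : 0 ≤ u) : 0 ≤ c • u := by
  rw [← Lp.coeFn_nonneg]
  filter_upwards [(Lp.coeFn_nonneg u).2 hu, Lp.coeFn_smul c u] with x h1 h2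
  rw [h2]
  exact mul_nonneg hc h1

theorem smul_le_smul_Lp {c : ℝ} (hc : 0 ≤ c) {u v : Lp ℝ 2 μ} (h : u ≤ v) : c • u ≤ c • v := by
  rw [← sub_nonneg, ← smul_sub]
  exact smul_nonneg_Lp hc (sub_nonneg.2 h)

theorem tendsto_of_dominated {F : ℕ → Lp ℝ 2 μ} {f g : Lp ℝ 2 μ}
    (hb : ∀ n, ∀ᵐ x ∂μ, |F n x - f x| ≤ |g x|)
    (hlim : ∀ᵐ x ∂μ, Tendsto (fun n => F n x) atTop (𝓝 (f x))) : Tendsto F atTop (𝓝 f) := by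
  rw [tendsto_iff_norm_sub_tendsto_zero]
  have h1 : Tendsto (fun n => ∫ x, (F n x - f x) ^ 2 ∂μ) atTop (𝓝 (∫ _, (0 : ℝ) ∂μ)) := by
    refine tendsto_integral_of_dominated_convergence (fun x => (g x) ^ 2) (fun n => ?_)
      (Lp.memLp g).integrable_sq (fun n => ?_) ?_
    · exact ((Lp.aestronglyMeasurable (F n)).sub (Lp.aestronglyMeasurable f)).pow 2
    · filter_upwards [hb n] with x hx
      rw [Real.norm_eq_abs, abs_pow]
      calc |F n x - f x| ^ 2 ≤ |g x| ^ 2 := by gcongr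
        _ = g x ^ 2 := sq_abs _
    · filter_upwards [hlim] with x hx
      simpa using (hx.sub_const (f x)).pow 2
  have h2 : ∀ n, ‖F n - f‖ = √(∫ x, (F n x - f x) ^ 2 ∂μ) := fun n => by
    rw [← Real.sqrt_sq (norm_nonneg (F n - f)), ← real_inner_self_eq_norm_sq, inner_eq_integral]
    congr 1
    refine integral_congr_ae ?_
    filter_upwards [Lp.coeFn_sub (F n) f] with x hx
    rw [hx, Pi.sub_apply, sq]
  simp only [h2]
  rw [integral_zero] at h1
  have h3 := (Real.continuous_sqrt.tendsto 0).comp h1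
  rw [Real.sqrt_zero] at h3
  exact h3

/-- The functions `u` in `L₂` with `0 ≤ u ≤ 1`. -/
def unitInterval (μ : Measure X) : Set (Lp ℝ 2 μ) := {u | 0 ≤ u ∧ ∀ᵐ x ∂μ, u x ≤ 1}

theorem convex_unitInterval : Convex ℝ (unitInterval μ) := by
  intro u hu v hv a b ha hb hab
  refine ⟨add_nonneg (smul_nonneg_Lp ha hu.1) (smul_nonneg_Lp hb hv.1), ?_⟩
  filter_upwards [hu.2, hv.2, Lp.coeFn_add (a • u) (b • v), Lp.coeFn_smul a u,
    Lp.coeFn_smul b v] with x h1 h2 h3 h4 h5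
  rw [h3, Pi.add_apply, h4, h5, Pi.smul_apply, Pi.smul_apply, smul_eq_mul, smul_eq_mul]
  calc a * u x + b * v x ≤ a * 1 + b * 1 := by gcongr
    _ = 1 := by rw [mul_one, mul_one, hab]

theorem isClosed_unitInterval : IsClosed (unitInterval μ) := by
  refine IsClosed.inter isClosed_nonneg (IsSeqClosed.isClosed fun u f hu hlim => ?_)
  obtain ⟨φ, -, hφ⟩ := (tendstoInMeasure_of_tendsto_Lp hlim).exists_seq_tendsto_ae
  filter_upwards [ae_all_iff.2 hu, hφ] with x hx hφx
  exact le_of_tendsto' hφx fun _ => hx _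

end Lattice

/-! ### The form domain as a lattice -/

section FormLattice

variable {X : Type*} [MeasurableSpace X] {μ : Measure X} (E : DirichletForm μ)

/-- If `u` is in the form domain, then so is its positive part: it is the limit of the functions
`0 ∨ u ∧ n = n (0 ∨ u / n ∧ 1)`, which are bounded in the graph norm. -/
theorem pos_mem {u : Lp ℝ 2 μ} (hu : u ∈ E.domain) : u⁺ ∈ E.domain := by
  have hex : ∀ n : ℕ, ∃ w : E.domain, ((w : Lp ℝ 2 μ) : X → ℝ) =ᵐ[μ]
      (fun x => max 0 (min (u x) ((n : ℝ) + 1))) ∧ E.form w w ≤ E.form ⟨u, hu⟩ ⟨u, hu⟩ := fun n => by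
    have hn : (0 : ℝ) < (n : ℝ) + 1 := by positivity
    obtain ⟨w, hw1, hw2⟩ := E.markov (((n : ℝ) + 1)⁻¹ • ⟨u, hu⟩)
    refine ⟨((n : ℝ) + 1) • w, ?_, ?_⟩
    · filter_upwards [hw1, Lp.coeFn_smul ((n : ℝ) + 1) (w : Lp ℝ 2 μ),
        Lp.coeFn_smul ((n : ℝ) + 1)⁻¹ u] with x h1 h2 h3
      rw [Submodule.coe_smul, h2, Pi.smul_apply, h1, Submodule.coe_smul, h3, Pi.smul_apply,
        smul_eq_mul, smul_eq_mul, mul_max_of_nonneg _ _ hn.le, mul_min_of_nonneg _ _ hn.le,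
        mul_zero, mul_one, mul_inv_cancel_left₀ hn.ne']
    · simp only [map_smul, LinearMap.smul_apply, smul_eq_mul] at hw2 ⊢
      calc ((n : ℝ) + 1) * (((n : ℝ) + 1) * E.form w w)
          ≤ ((n : ℝ) + 1) * (((n : ℝ) + 1) * (((n : ℝ) + 1)⁻¹ * (((n : ℝ) + 1)⁻¹ *
            E.form ⟨u, hu⟩ ⟨u, hu⟩))) := by gcongr
        _ = _ := by field_simp
  choose w hw1 hw2 using hex
  have hb : ∀ n, ‖(w n : Lp ℝ 2 μ)‖ ≤ ‖u‖ := fun n => by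
    refine Lp.norm_le_norm_of_ae_le ?_
    filter_upwards [hw1 n] with x hx
    rw [hx, Real.norm_eq_abs, Real.norm_eq_abs, abs_of_nonneg (le_max_left _ _)]
    exact max_le (abs_nonneg _) ((min_le_left _ _).trans (le_abs_self _))
  obtain ⟨v, -, hv⟩ := E.exists_mem_graphClosure_of_tendsto (D := ⊤) (u := w) (h := u⁺)
    (C := E.form ⟨u, hu⟩ ⟨u, hu⟩ + ‖u‖ ^ 2)
    (fun n => E.mem_graphClosure_of_mem trivial)
    (fun n => by
      unfold ClosedForm.normSq
      have := hb n
      have := hw2 n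
      gcongr) (by
      refine tendsto_of_dominated (g := u) (fun n => ?_) ?_
      · filter_upwards [hw1 n, coeFn_pos u] with x h1 h2
        rw [h1, h2]
        have hn : (0 : ℝ) < (n : ℝ) + 1 := by positivity
        rcases le_total (u x) 0 with h | h
        · rw [max_eq_right h, max_eq_left ((min_le_left _ _).trans h)]; simp
        · rw [max_eq_left h, max_eq_right (le_min h hn.le), abs_of_nonneg h, abs_sub_comm,
            abs_of_nonneg (sub_nonneg.2 (min_le_left _ _))]
          linarith [le_min h hn.le]
      · filter_upwards [ae_all_iff.2 hw1, coeFn_pos u] with x h1 h2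
        refine tendsto_const_nhds.congr' ?_
        obtain ⟨N, hN⟩ := exists_nat_ge (u x)
        filter_upwards [eventually_ge_atTop N] with n hn
        have : u x ≤ (n : ℝ) + 1 := by
          have : (N : ℝ) ≤ n := by exact_mod_cast hn
          linarith
        rw [h1, h2, min_eq_left this, max_comm])
  rw [← hv]
  exact v.2

theorem neg_part_mem {u : Lp ℝ 2 μ} (hu : u ∈ E.domain) : u⁻ ∈ E.domain := by
  rw [← posPart_neg]
  exact E.pos_mem (neg_mem hu)

theorem inf_mem {u v : Lp ℝ 2 μ} (hu : u ∈ E.domain) (hv : v ∈ E.domain) :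
    u ⊓ v ∈ E.domain := by
  rw [inf_eq_sub_posPart_sub]
  exact sub_mem hu (E.pos_mem (sub_mem hu hv))

variable {E}

theorem normSq_add_of_mul_eq_zero (hloc : E.IsLocal) {u v : E.domain}
    (h : ∀ᵐ x ∂μ, (u : Lp ℝ 2 μ) x * (v : Lp ℝ 2 μ) x = 0) :
    E.normSq (u + v) = E.normSq u + E.normSq v := by
  have h1 := hloc u v h
  have h2 := E.symm u v
  have h3 := norm_add_sq_real (u : Lp ℝ 2 μ) v
  rw [inner_eq_zero_of_mul_eq_zero h] at h3
  simp only [ClosedForm.normSq, map_add, LinearMap.add_apply, Submodule.coe_add, h3]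
  linarith

theorem normSq_pos_le (hloc : E.IsLocal) {u : Lp ℝ 2 μ} (hu : u ∈ E.domain) :
    E.normSq ⟨u⁺, E.pos_mem hu⟩ ≤ E.normSq ⟨u, hu⟩ := by
  have h := normSq_add_of_mul_eq_zero hloc (u := ⟨u⁺, E.pos_mem hu⟩)
    (v := ⟨(-1 : ℝ) • u⁻, Submodule.smul_mem _ _ (E.neg_part_mem hu)⟩) (by
      filter_upwards [pos_mul_neg_eq_zero u, Lp.coeFn_smul (-1 : ℝ) u⁻] with x h1 h2
      simp only [h2, Pi.smul_apply, smul_eq_mul]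
      linear_combination -h1)
  have e : (⟨u⁺, E.pos_mem hu⟩ + ⟨(-1 : ℝ) • u⁻, Submodule.smul_mem _ _ (E.neg_part_mem hu)⟩ :
      E.domain) = ⟨u, hu⟩ := Subtype.ext (by
    show u⁺ + (-1 : ℝ) • u⁻ = u
    rw [neg_one_smul, ← sub_eq_add_neg, posPart_sub_negPart])
  rw [e] at h
  have := E.normSq_nonneg ⟨(-1 : ℝ) • u⁻, Submodule.smul_mem _ _ (E.neg_part_mem hu)⟩
  linarith

theorem normSq_inf_le (hloc : E.IsLocal) {u v : Lp ℝ 2 μ}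
    (hu : u ∈ E.domain) (hv : v ∈ E.domain) :
    E.normSq ⟨u ⊓ v, E.inf_mem hu hv⟩ ≤ 6 * E.normSq ⟨u, hu⟩ + 4 * E.normSq ⟨v, hv⟩ := by
  have e : (⟨u ⊓ v, E.inf_mem hu hv⟩ : E.domain) =
      ⟨u, hu⟩ - ⟨(u - v)⁺, E.pos_mem (sub_mem hu hv)⟩ := Subtype.ext (inf_eq_sub_posPart_sub u v)
  rw [e]
  have h1 := E.normSq_sub_le ⟨u, hu⟩ ⟨(u - v)⁺, E.pos_mem (sub_mem hu hv)⟩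
  have h2 := normSq_pos_le hloc (sub_mem hu hv)
  have h3 : E.normSq ⟨u - v, sub_mem hu hv⟩ ≤ _ := E.normSq_sub_le ⟨u, hu⟩ ⟨v, hv⟩
  linarith

/-- Testing a supersolution with its negative part shows that it is nonnegative. -/
theorem nonneg_of_form_neg_part (hloc : E.IsLocal) {β : ℝ} (hβ : 0 < β) {u : Lp ℝ 2 μ}
    (hu : u ∈ E.domain)
    (h : 0 ≤ E.form ⟨u, hu⟩ ⟨u⁻, E.neg_part_mem hu⟩ + β * inner ℝ u u⁻) : 0 ≤ u := by
  have e : (⟨u, hu⟩ : E.domain) = ⟨u⁺, E.pos_mem hu⟩ - ⟨u⁻, E.neg_part_mem hu⟩ :=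
    Subtype.ext (posPart_sub_negPart u).symm
  have h1 := hloc ⟨u⁺, E.pos_mem hu⟩ ⟨u⁻, E.neg_part_mem hu⟩ (pos_mul_neg_eq_zero u)
  have h2 := inner_eq_zero_of_mul_eq_zero (pos_mul_neg_eq_zero u)
  have h3 := E.nonneg ⟨u⁻, E.neg_part_mem hu⟩
  have h4 : inner ℝ u u⁻ = -‖u⁻‖ ^ 2 := by
    nth_rewrite 1 [← posPart_sub_negPart u]
    rw [inner_sub_left, h2, real_inner_self_eq_norm_sq, zero_sub]
  rw [e, map_sub, LinearMap.sub_apply, h1, h4] at h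
  have h5 : β * ‖u⁻‖ ^ 2 = 0 := le_antisymm (by linarith) (by positivity)
  have h6 : u⁻ = 0 := by simpa [hβ.ne'] using h5
  exact negPart_eq_zero.1 h6

theorem resolvent_nonneg (hloc : E.IsLocal) {β : ℝ} (hβ : 0 < β) {f : Lp ℝ 2 μ}
    (hf : 0 ≤ f) : 0 ≤ E.resolvent β f := by
  refine nonneg_of_form_neg_part hloc hβ (E.resolvent_mem hβ f) ?_
  have h := E.resolventFun_spec hβ f ⟨_, E.neg_part_mem (E.resolvent_mem hβ f)⟩
  have e : (⟨_, E.resolvent_mem hβ f⟩ : E.domain) = E.resolventFun hβ f :=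
    Subtype.ext (E.resolvent_apply hβ f)
  rw [← e] at h
  rw [h]
  exact inner_nonneg_of_nonneg hf (negPart_nonneg _)

/-- The operator `β (β + A)⁻¹` is submarkovian: its value `u` at `f` minimizes
`E(u, u) + β ‖u - f‖ ^ 2`, and this functional does not increase when `u` is replaced by
`0 ∨ u ∧ 1`. -/
theorem smul_resolvent_mem_unitInterval {β : ℝ} (hβ : 0 < β) {f : Lp ℝ 2 μ}
    (hf : f ∈ unitInterval μ) : β • E.resolvent β f ∈ unitInterval μ := by
  set u : E.domain := β • E.resolventFun hβ f with hu
  have hspec : ∀ v : E.domain, E.form u v = β * (inner ℝ f (v : Lp ℝ 2 μ) -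
      inner ℝ (u : Lp ℝ 2 μ) v) := fun v => by
    have h := E.resolventFun_spec hβ f v
    rw [hu, map_smul, LinearMap.smul_apply, Submodule.coe_smul, inner_smul_left, smul_eq_mul, ← h]
    simp only [conj_trivial]
    ring
  obtain ⟨w, hw1, hw2⟩ := E.markov u
  have hwf : ‖(w : Lp ℝ 2 μ) - f‖ ≤ ‖(u : Lp ℝ 2 μ) - f‖ := by
    refine Lp.norm_le_norm_of_ae_le ?_
    filter_upwards [hw1, (Lp.coeFn_nonneg f).2 hf.1, hf.2, Lp.coeFn_sub (w : Lp ℝ 2 μ) f,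
      Lp.coeFn_sub (u : Lp ℝ 2 μ) f] with x h1 h2 h3 h4 h5
    have h2' : 0 ≤ f x := h2
    rw [h4, h5, Pi.sub_apply, Pi.sub_apply, h1, Real.norm_eq_abs, Real.norm_eq_abs]
    have e : f x = max 0 (min (f x) 1) := by rw [min_eq_left h3, max_eq_right h2']
    nth_rewrite 1 [e]
    rw [max_comm 0, max_comm 0]
    exact (abs_max_sub_max_le_abs _ _ _).trans (abs_inf_sub_inf_le_abs _ _ _)
  have h1 := E.nonneg (u - w)
  have h2 : E.form (u - w) (u - w) = E.form u u - 2 * E.form u w + E.form w w := by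
    simp only [map_sub, LinearMap.sub_apply]
    rw [E.symm w u]
    ring
  have h3 := norm_sub_sq_real (w : Lp ℝ 2 μ) f
  have h4 := norm_sub_sq_real (u : Lp ℝ 2 μ) f
  have h5 := norm_sub_sq_real (u : Lp ℝ 2 μ) w
  have h6 := hspec u
  have h7 := hspec w
  have h8 : ‖(w : Lp ℝ 2 μ) - f‖ ^ 2 ≤ ‖(u : Lp ℝ 2 μ) - f‖ ^ 2 := by gcongr
  rw [real_inner_self_eq_norm_sq] at h6
  have h9 : β * ‖(u : Lp ℝ 2 μ) - w‖ ^ 2 ≤ 0 := by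
    rw [real_inner_comm] at h3 h4
    have h10 := mul_le_mul_of_nonneg_left h8 hβ.le
    rw [h3, h4] at h10
    rw [h5]
    linarith
  have h10 : ‖(u : Lp ℝ 2 μ) - w‖ ^ 2 = 0 :=
    le_antisymm (nonpos_of_mul_nonpos_right h9 hβ) (by positivity)
  have h11 : (u : Lp ℝ 2 μ) = w := by simpa [sub_eq_zero] using h10
  have h12 : β • E.resolvent β f = (w : Lp ℝ 2 μ) := by
    rw [← h11, hu, E.resolvent_apply hβ]; rfl
  rw [h12]
  refine ⟨(Lp.coeFn_nonneg _).1 ?_, ?_⟩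
  · filter_upwards [hw1] with x hx
    rw [hx]
    exact le_max_left _ _
  · filter_upwards [hw1] with x hx
    rw [hx]
    exact max_le zero_le_one (min_le_right _ _)

end FormLattice

/-! ### Functions on an open subset and supports -/

section Restriction

variable {X : Type*} [MeasurableSpace X] {μ : Measure X} {Ω : Set X}

theorem coeFn_extendByZero (hΩ : MeasurableSet Ω) (g : Lp ℝ 2 (μ.restrict Ω)) :
    (extendByZero hΩ g : X → ℝ) =ᵐ[μ] Ω.indicator g := by
  have e : extendByZero hΩ g =
    ((memLp_indicator_iff_restrict hΩ).2 (Lp.memLp g)).toLp (Ω.indicator g) := rfl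
  rw [e]
  exact MemLp.coeFn_toLp _

/-- Multiplication by the indicator function of `Ω` on `L₂(X)`. -/
noncomputable def indicatorCLM (hΩ : MeasurableSet Ω) : Lp ℝ 2 μ →L[ℝ] Lp ℝ 2 μ :=
  (extendByZero hΩ).toContinuousLinearMap ∘L LpToLpRestrictCLM X ℝ ℝ μ 2 Ω

theorem indicatorCLM_apply (hΩ : MeasurableSet Ω) (u : Lp ℝ 2 μ) :
    indicatorCLM hΩ u = extendByZero hΩ (LpToLpRestrictCLM X ℝ ℝ μ 2 Ω u) := rfl

theorem coeFn_indicatorCLM (hΩ : MeasurableSet Ω) (u : Lp ℝ 2 μ) :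
    (indicatorCLM hΩ u : X → ℝ) =ᵐ[μ] Ω.indicator u :=
  (coeFn_extendByZero hΩ _).trans
    ((ae_eq_restrict_iff_indicator_ae_eq hΩ).1 (LpToLpRestrictCLM_coeFn ℝ Ω u))

theorem indicatorCLM_eq_self (hΩ : MeasurableSet Ω) {u : Lp ℝ 2 μ}
    (hu : ∀ᵐ x ∂μ, x ∉ Ω → u x = 0) : indicatorCLM hΩ u = u := by
  refine Lp.ext ?_
  filter_upwards [coeFn_indicatorCLM hΩ u, hu] with x h1 h2
  rw [h1]
  by_cases hx : x ∈ Ω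
  · rw [Set.indicator_of_mem hx]
  · rw [Set.indicator_of_notMem hx, h2 hx]

theorem extendByZero_ae_eq_zero (hΩ : MeasurableSet Ω) (g : Lp ℝ 2 (μ.restrict Ω)) :
    ∀ᵐ x ∂μ, x ∉ Ω → extendByZero hΩ g x = 0 := by
  filter_upwards [coeFn_extendByZero hΩ g] with x h1 hx
  rw [h1, Set.indicator_of_notMem hx]

theorem indicatorCLM_extendByZero (hΩ : MeasurableSet Ω) (g : Lp ℝ 2 (μ.restrict Ω)) :
    indicatorCLM hΩ (extendByZero hΩ g) = extendByZero hΩ g :=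
  indicatorCLM_eq_self hΩ (extendByZero_ae_eq_zero hΩ g)

theorem indicatorCLM_mul_sub (hΩ : MeasurableSet Ω) (u v : Lp ℝ 2 μ) :
    ∀ᵐ x ∂μ, indicatorCLM hΩ u x * (v - indicatorCLM hΩ v) x = 0 := by
  filter_upwards [coeFn_indicatorCLM hΩ u, coeFn_indicatorCLM hΩ v,
    Lp.coeFn_sub v (indicatorCLM hΩ v)] with x h1 h2 h3
  rw [h3, Pi.sub_apply, h1, h2]
  by_cases hx : x ∈ Ω <;> simp [hx]

theorem inner_extendByZero_indicatorCLM (hΩ : MeasurableSet Ω) (g : Lp ℝ 2 (μ.restrict Ω))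
    (u : Lp ℝ 2 μ) :
    inner ℝ (extendByZero hΩ g) (indicatorCLM hΩ u) = inner ℝ (extendByZero hΩ g) u := by
  have h := inner_eq_zero_of_mul_eq_zero (indicatorCLM_mul_sub hΩ (extendByZero hΩ g) u)
  rw [indicatorCLM_extendByZero, inner_sub_right] at h
  linarith

theorem extendByZero_nonneg (hΩ : MeasurableSet Ω) {g : Lp ℝ 2 (μ.restrict Ω)} (hg : 0 ≤ g) :
    0 ≤ extendByZero hΩ g := by
  rw [← Lp.coeFn_nonneg]
  filter_upwards [coeFn_extendByZero hΩ g,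
    (ae_restrict_iff' hΩ).1 ((Lp.coeFn_nonneg g).2 hg)] with x h1 h2
  rw [h1]
  by_cases hx : x ∈ Ω
  · rw [Set.indicator_of_mem hx]
    exact h2 hx
  · rw [Set.indicator_of_notMem hx]
    exact le_rfl

theorem nonneg_of_extendByZero_nonneg (hΩ : MeasurableSet Ω) {g : Lp ℝ 2 (μ.restrict Ω)}
    (hg : 0 ≤ extendByZero hΩ g) : 0 ≤ g := by
  rw [← Lp.coeFn_nonneg]
  refine (ae_restrict_iff' hΩ).2 ?_
  filter_upwards [coeFn_extendByZero hΩ g, (Lp.coeFn_nonneg _).2 hg] with x h1 h2 hx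
  rw [h1, Set.indicator_of_mem hx] at h2
  exact h2

end Restriction

section Support

variable {X : Type*} [TopologicalSpace X] [MeasurableSpace X] {μ : Measure X}

theorem ae_eq_zero_of_notMem_essSupport [SecondCountableTopology X] (u : Lp ℝ 2 μ) :
    ∀ᵐ x ∂μ, x ∉ essSupport u → u x = 0 := by
  have h : μ {x | x ∉ essSupport u ∧ u x ≠ 0} = 0 := by
    refine measure_null_of_locally_null _ fun x hx => ?_
    have hx' := hx.1
    simp only [essSupport, Set.mem_ofPred_eq, not_forall, not_not] at hx'
    obtain ⟨U, hU, hu⟩ := hx'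
    refine ⟨{x | x ∉ essSupport u ∧ u x ≠ 0} ∩ U,
      inter_mem self_mem_nhdsWithin (mem_nhdsWithin_of_mem_nhds hU), ?_⟩
    refine nonpos_iff_eq_zero.1 ((Measure.le_restrict_apply U _).trans ?_)
    refine (measure_mono fun y hy => ?_).trans (ae_iff.1 hu).le
    exact hy.2
  rw [ae_iff]
  convert h using 3
  simp

theorem essSupport_subset_of_ae {u : Lp ℝ 2 μ} {F : Set X} (hF : IsClosed F)
    (h : ∀ᵐ x ∂μ, x ∉ F → u x = 0) [OpensMeasurableSpace X] : essSupport u ⊆ F := by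
  intro x hx
  by_contra hxF
  refine hx Fᶜ (hF.isOpen_compl.mem_nhds hxF) ?_
  exact (ae_restrict_iff' hF.isOpen_compl.measurableSet).2 h

end Support

/-! ### The form with Dirichlet boundary conditions -/

theorem semigroup_mem_unitInterval {X : Type*} [MeasurableSpace X] {μ : Measure X}
    {E : DirichletForm μ} {t : ℝ} (ht : 0 < t) {f : Lp ℝ 2 μ}
    (hf : f ∈ unitInterval μ) : E.semigroup t f ∈ unitInterval μ :=
  E.semigroup_mem_of_resolvent_mem convex_unitInterval isClosed_unitInterval
    (fun _ hβ _ hg => smul_resolvent_mem_unitInterval hβ hg) ht hf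

section Dirichlet

variable {X : Type*} [TopologicalSpace X] [SecondCountableTopology X] [MeasurableSpace X]
  {μ : Measure X} {E : DirichletForm μ} {Ω : Set X}

theorem indicatorCLM_of_mem_graphClosure (hΩ : MeasurableSet Ω) {v : E.domain}
    (hv : v ∈ E.graphClosure (compactSupportDomain E.toClosedForm Ω)) :
    indicatorCLM hΩ (v : Lp ℝ 2 μ) = v := by
  obtain ⟨u, hu, -, hlim⟩ := E.exists_seq_of_mem_graphClosure hv
  refine tendsto_nhds_unique (((indicatorCLM hΩ).continuous.tendsto _).comp hlim) ?_
  refine hlim.congr fun n => ?_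
  refine (indicatorCLM_eq_self hΩ ?_).symm
  filter_upwards [ae_eq_zero_of_notMem_essSupport (u n : Lp ℝ 2 μ)] with x h1 hx
  exact h1 fun h => hx ((hu n).2 h)

/-- The defining equation of the resolvent of the form with Dirichlet boundary conditions, read
in `L₂(X)`. -/
theorem exists_dirichlet_resolvent (hΩ : MeasurableSet Ω) {β : ℝ} (hβ : 0 < β)
    (f : Lp ℝ 2 (μ.restrict Ω)) :
    ∃ w ∈ E.graphClosure (compactSupportDomain E.toClosedForm Ω),
      (w : Lp ℝ 2 μ) =
        extendByZero hΩ ((dirichletRestriction E.toClosedForm hΩ).resolvent β f) ∧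
      ∀ v ∈ E.graphClosure (compactSupportDomain E.toClosedForm Ω),
        E.form w v + β * inner ℝ (w : Lp ℝ 2 μ) v = inner ℝ (extendByZero hΩ f) (v : Lp ℝ 2 μ) := by
  obtain ⟨w, hw, hwf, hspec⟩ := E.pullback_resolvent_spec
    (compactSupportDomain E.toClosedForm Ω) (extendByZero hΩ) hβ f
  refine ⟨w, hw, hwf, fun v hv => hspec v hv ?_⟩
  rw [← indicatorCLM_of_mem_graphClosure hΩ hv]
  exact ⟨_, rfl⟩

variable [OpensMeasurableSpace X]

theorem mem_compactSupportDomain_of_ae {u v : E.domain}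
    (hv : v ∈ compactSupportDomain E.toClosedForm Ω)
    (h : ∀ᵐ x ∂μ, (v : Lp ℝ 2 μ) x = 0 → (u : Lp ℝ 2 μ) x = 0) :
    u ∈ compactSupportDomain E.toClosedForm Ω := by
  have hs : essSupport (u : Lp ℝ 2 μ) ⊆ essSupport (v : Lp ℝ 2 μ) := by
    refine essSupport_subset_of_ae (isClosed_essSupport _) ?_
    filter_upwards [h, ae_eq_zero_of_notMem_essSupport (v : Lp ℝ 2 μ)] with x h1 h2 hx
    exact h1 (h2 hx)
  exact ⟨hv.1.of_isClosed_subset (isClosed_essSupport _) hs, hs.trans hv.2⟩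

theorem pos_mem_graphClosure (hloc : E.IsLocal) {v : E.domain}
    (hv : v ∈ E.graphClosure (compactSupportDomain E.toClosedForm Ω)) :
    ⟨(v : Lp ℝ 2 μ)⁺, E.pos_mem v.2⟩ ∈ E.graphClosure (compactSupportDomain E.toClosedForm Ω) := by
  obtain ⟨u, hu, hb, hlim⟩ := E.exists_seq_of_mem_graphClosure hv
  obtain ⟨w, hw, hwv⟩ := E.exists_mem_graphClosure_of_tendsto
    (u := fun n => ⟨(u n : Lp ℝ 2 μ)⁺, E.pos_mem (u n).2⟩) (h := (v : Lp ℝ 2 μ)⁺)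
    (fun n => E.mem_graphClosure_of_mem (mem_compactSupportDomain_of_ae (hu n) (by
      filter_upwards [coeFn_pos (u n : Lp ℝ 2 μ)] with x h1 h2
      rw [h1, h2, max_self])))
    (fun n => (normSq_pos_le hloc (u n).2).trans (hb n))
    ((continuous_posPart.tendsto _).comp hlim)
  have e : (⟨(v : Lp ℝ 2 μ)⁺, E.pos_mem v.2⟩ : E.domain) = w := Subtype.ext hwv.symm
  rw [e]
  exact hw

/-- The domain of the form with Dirichlet boundary conditions is an order ideal in the form
domain. -/
theorem mem_graphClosure_of_le (hloc : E.IsLocal) {u v : E.domain}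
    (hv : v ∈ E.graphClosure (compactSupportDomain E.toClosedForm Ω))
    (hu0 : 0 ≤ (u : Lp ℝ 2 μ)) (huv : (u : Lp ℝ 2 μ) ≤ v) :
    u ∈ E.graphClosure (compactSupportDomain E.toClosedForm Ω) := by
  obtain ⟨s, hs, hb, hlim⟩ := E.exists_seq_of_mem_graphClosure hv
  obtain ⟨w, hw, hwu⟩ := E.exists_mem_graphClosure_of_tendsto
    (u := fun n => ⟨(u : Lp ℝ 2 μ) ⊓ (s n : Lp ℝ 2 μ)⁺, E.inf_mem u.2 (E.pos_mem (s n).2)⟩)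
    (h := (u : Lp ℝ 2 μ)) (C := 6 * E.normSq u + 4 * (2 * E.normSq v + 2))
    (fun n => E.mem_graphClosure_of_mem (mem_compactSupportDomain_of_ae (hs n) (by
      filter_upwards [coeFn_pos (s n : Lp ℝ 2 μ), Lp.coeFn_inf (u : Lp ℝ 2 μ) (s n : Lp ℝ 2 μ)⁺,
        (Lp.coeFn_nonneg _).2 hu0] with x h1 h2 h3 h4
      rw [h2, Pi.inf_apply, h1, h4, max_self]
      exact inf_eq_right.2 h3)))
    (fun n => by
      have h1 := normSq_inf_le hloc u.2 (E.pos_mem (s n).2)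
      have h2 := normSq_pos_le hloc (s n).2
      have h3 := hb n
      have e1 : (⟨(u : Lp ℝ 2 μ), u.2⟩ : E.domain) = u := rfl
      have e2 : (⟨(s n : Lp ℝ 2 μ), (s n).2⟩ : E.domain) = s n := rfl
      rw [e1] at h1
      rw [e2] at h2
      linarith)
    (by
      have h1 := (tendsto_const_nhds (x := (u : Lp ℝ 2 μ))).inf_nhds
        ((continuous_posPart.tendsto _).comp hlim)
      rwa [posPart_of_nonneg (hu0.trans huv), inf_eq_left.2 huv] at h1)
  have e : u = w := Subtype.ext hwu.symm
  rw [e]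
  exact hw

theorem dirichlet_resolvent_nonneg (hloc : E.IsLocal) (hΩ : MeasurableSet Ω) {β : ℝ} (hβ : 0 < β)
    {f : Lp ℝ 2 (μ.restrict Ω)} (hf : 0 ≤ f) :
    0 ≤ (dirichletRestriction E.toClosedForm hΩ).resolvent β f := by
  obtain ⟨w, hw, hwf, hspec⟩ := exists_dirichlet_resolvent (E := E) hΩ hβ f
  apply nonneg_of_extendByZero_nonneg hΩ
  rw [← hwf]
  refine nonneg_of_form_neg_part hloc hβ w.2 ?_
  have hn : (⟨(w : Lp ℝ 2 μ)⁻, E.neg_part_mem w.2⟩ : E.domain) ∈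
      E.graphClosure (compactSupportDomain E.toClosedForm Ω) := by
    have e : (⟨(w : Lp ℝ 2 μ)⁻, E.neg_part_mem w.2⟩ : E.domain) =
        ⟨((-w : E.domain) : Lp ℝ 2 μ)⁺, E.pos_mem (-w).2⟩ := Subtype.ext (posPart_neg (w : Lp ℝ 2 μ)).symm
    rw [e]
    exact pos_mem_graphClosure hloc (neg_mem hw)
  have h := hspec _ hn
  have e : (⟨(w : Lp ℝ 2 μ), w.2⟩ : E.domain) = w := rfl
  rw [e, h]
  exact inner_nonneg_of_nonneg (extendByZero_nonneg hΩ hf) (negPart_nonneg _)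

/-- Domination of the resolvent with Dirichlet boundary conditions by the resolvent on `X`. -/
theorem dirichlet_resolvent_le (hloc : E.IsLocal) (hΩ : MeasurableSet Ω) {β : ℝ} (hβ : 0 < β)
    {f : Lp ℝ 2 (μ.restrict Ω)} (hf : 0 ≤ f) :
    extendByZero hΩ ((dirichletRestriction E.toClosedForm hΩ).resolvent β f) ≤
      E.resolvent β (extendByZero hΩ f) := by
  obtain ⟨w, hw, hwf, hspec⟩ := exists_dirichlet_resolvent (E := E) hΩ hβ f
  rw [← hwf, E.resolvent_apply hβ, ← sub_nonneg]
  set u := E.resolventFun hβ (extendByZero hΩ f) with hu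
  have hu0 : 0 ≤ (u : Lp ℝ 2 μ) := by
    rw [hu, ← E.resolvent_apply hβ]
    exact resolvent_nonneg hloc hβ (extendByZero_nonneg hΩ hf)
  refine nonneg_of_form_neg_part hloc hβ (u - w).2 (le_of_eq ?_)
  have hn : (⟨((u - w : E.domain) : Lp ℝ 2 μ)⁻, E.neg_part_mem (u - w).2⟩ : E.domain) ∈
      E.graphClosure (compactSupportDomain E.toClosedForm Ω) := by
    refine mem_graphClosure_of_le hloc (pos_mem_graphClosure hloc hw) (negPart_nonneg _) ?_
    show ((u - w : Lp ℝ 2 μ))⁻ ≤ (w : Lp ℝ 2 μ)⁺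
    rw [← posPart_neg, neg_sub]
    exact posPart_mono (sub_le_self _ hu0)
  have h1 := hspec _ hn
  have h2 := E.resolventFun_spec hβ (extendByZero hΩ f)
    ⟨((u - w : E.domain) : Lp ℝ 2 μ)⁻, E.neg_part_mem (u - w).2⟩
  rw [← hu] at h2
  show 0 = E.form (u - w) ⟨((u - w : E.domain) : Lp ℝ 2 μ)⁻, E.neg_part_mem (u - w).2⟩ +
    β * inner ℝ ((u : Lp ℝ 2 μ) - w) ((u - w : E.domain) : Lp ℝ 2 μ)⁻
  rw [LinearMap.map_sub, LinearMap.sub_apply, inner_sub_left]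
  linarith

/-! ### Order properties of the semigroups -/

theorem dirichletSemigroup_le (hloc : E.IsLocal) (hΩ : IsOpen Ω) {t : ℝ} (ht : 0 < t)
    {f : Lp ℝ 2 (μ.restrict Ω)} (hf : 0 ≤ f) :
    extendByZero hΩ.measurableSet (E.dirichletSemigroup hΩ t f) ≤
      E.semigroup t (extendByZero hΩ.measurableSet f) := by
  set F := dirichletRestriction E.toClosedForm hΩ.measurableSet with hF
  set J := extendByZero (μ := μ) hΩ.measurableSet
  refine le_of_tendsto_of_tendsto ((J.continuous.tendsto _).comp (F.tendsto_semigroup ht f))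
    (E.tendsto_semigroup ht (J f)) ?_
  filter_upwards [eventually_gt_atTop 0] with β hβ
  have hpow : ∀ n : ℕ, 0 ≤ ((β • F.resolvent β) ^ n) f ∧
      J (((β • F.resolvent β) ^ n) f) ≤ ((β • E.resolvent β) ^ n) (J f) := by
    intro n
    induction n with
    | zero => simpa using hf
    | succ n ih =>
      rw [pow_succ', pow_succ', mul_apply_eq_comp, mul_apply_eq_comp, _root_.smul_apply,
        _root_.smul_apply, map_smul]
      refine ⟨smul_nonneg_Lp hβ.le (dirichlet_resolvent_nonneg hloc _ hβ ih.1),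
        smul_le_smul_Lp hβ.le ((dirichlet_resolvent_le hloc _ hβ ih.1).trans ?_)⟩
      rw [← sub_nonneg, ← map_sub]
      exact resolvent_nonneg hloc hβ (sub_nonneg.2 ih.2)
  refine hasSum_le (fun n => ?_) ((F.hasSum_exp_yosida β t f).mapL J.toContinuousLinearMap)
    (E.hasSum_exp_yosida β t (J f))
  have h := smul_le_smul_Lp (c := Real.exp (-(t * β)) * ((t * β) ^ n / n.factorial))
    (by positivity) (hpow n).2
  rw [← map_smul] at h
  exact h

end Dirichlet

/-! ### Conservation and agreement of the semigroups -/

theorem coeFn_oneLinfty {X : Type*} [MeasurableSpace X] (ν : Measure X) :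
    (oneLinfty ν : X → ℝ) =ᵐ[ν] fun _ => 1 :=
  MemLp.coeFn_toLp (memLp_top_const (1 : ℝ))

theorem isInvariant_of_semigroupsAgree {X : Type*} [TopologicalSpace X] [MeasurableSpace X]
    [OpensMeasurableSpace X] {μ : Measure X} {E : DirichletForm μ} {Ω : Set X} (hΩ : IsOpen Ω)
    (h : E.SemigroupsAgree hΩ) : E.IsInvariant hΩ := fun φ t ht => ⟨_, (h φ t ht).symm⟩

section Conservation

variable {X : Type*} [MetricSpace X] [SigmaCompactSpace X] [MeasurableSpace X] [BorelSpace X]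

/-- The indicator function of the `n`-th set of the compact covering, as an element of `L₂`. -/
noncomputable def compactIndicator (ν : Measure X) [IsFiniteMeasureOnCompacts ν] (n : ℕ) :
    Lp ℝ 2 ν :=
  (memLp_two_indicator_compactCovering (oneLinfty ν) n).toLp
    ((compactCovering X n).indicator (oneLinfty ν))

theorem isConservative_iff {ν : Measure X} [IsFiniteMeasureOnCompacts ν]
    {S : ℝ → Lp ℝ 2 ν → Lp ℝ 2 ν} : IsConservative S ↔
      ∀ t : ℝ, 0 < t → ∀ᵐ x ∂ν, Tendsto (fun n => S t (compactIndicator ν n) x) atTop (𝓝 1) := by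
  refine forall₂_congr fun t _ => ?_
  unfold IsLinftyImage
  constructor <;> intro h <;> filter_upwards [h, coeFn_oneLinfty ν] with x h1 h2
  · rw [h2] at h1
    exact h1
  · rw [h2]
    exact h1

theorem coeFn_compactIndicator (ν : Measure X) [IsFiniteMeasureOnCompacts ν] (n : ℕ) :
    (compactIndicator ν n : X → ℝ) =ᵐ[ν] (compactCovering X n).indicator (fun _ => 1) := by
  filter_upwards [MemLp.coeFn_toLp (memLp_two_indicator_compactCovering (oneLinfty ν) n),
    coeFn_oneLinfty ν] with x h1 h2
  rw [compactIndicator, h1]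
  by_cases hx : x ∈ compactCovering X n
  · rw [Set.indicator_of_mem hx, Set.indicator_of_mem hx, h2]
  · rw [Set.indicator_of_notMem hx, Set.indicator_of_notMem hx]

theorem compactIndicator_nonneg (ν : Measure X) [IsFiniteMeasureOnCompacts ν] (n : ℕ) :
    0 ≤ compactIndicator ν n := by
  rw [← Lp.coeFn_nonneg]
  filter_upwards [coeFn_compactIndicator ν n] with x h1
  rw [h1]
  exact Set.indicator_nonneg (fun _ _ => zero_le_one) x

theorem compactIndicator_mono (ν : Measure X) [IsFiniteMeasureOnCompacts ν] :
    Monotone (compactIndicator ν) := by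
  intro m n hmn
  rw [← Lp.coeFn_le]
  filter_upwards [coeFn_compactIndicator ν m, coeFn_compactIndicator ν n] with x h1 h2
  rw [h1, h2]
  exact Set.indicator_le_indicator_of_subset (compactCovering_subset X hmn)
    (fun _ => zero_le_one) x

variable {μ : Measure X} [IsFiniteMeasureOnCompacts μ] {Ω : Set X}

theorem coeFn_extendByZero_compactIndicator (hΩ : MeasurableSet Ω) (n : ℕ) :
    (extendByZero hΩ (compactIndicator (μ.restrict Ω) n) : X → ℝ) =ᵐ[μ]
      (compactCovering X n ∩ Ω).indicator (fun _ => 1) := by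
  filter_upwards [coeFn_extendByZero hΩ (compactIndicator (μ.restrict Ω) n),
    (ae_restrict_iff' hΩ).1 (coeFn_compactIndicator (μ.restrict Ω) n)] with x h1 h2
  rw [h1]
  by_cases hx : x ∈ Ω
  · rw [Set.indicator_of_mem hx, h2 hx]
    by_cases hK : x ∈ compactCovering X n <;> simp [hx, hK]
  · simp [hx]

theorem extendByZero_compactIndicator_mem_unitInterval (hΩ : MeasurableSet Ω) (n : ℕ) :
    extendByZero hΩ (compactIndicator (μ.restrict Ω) n) ∈ unitInterval μ := by
  refine ⟨extendByZero_nonneg hΩ (compactIndicator_nonneg _ n), ?_⟩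
  filter_upwards [coeFn_extendByZero_compactIndicator (μ := μ) hΩ n] with x h1
  rw [h1]
  exact Set.indicator_le_self' (fun _ _ => zero_le_one) x

variable {E : DirichletForm μ}

/-- If `S^D` is conservative, then `S_t` and `S^D_t` agree up to multiplication by the indicator
function of `Ω`: by domination the defects `S_t (𝟙_K) - S^D_t (𝟙_K)`, for compact `K`, increase
with `K` and are bounded on `Ω` by `1 - S^D_t (𝟙_K)`, which tends to `0`. -/
theorem indicatorCLM_semigroup_of_isConservative (hloc : E.IsLocal) (hΩ : IsOpen Ω)
    (hc : IsConservative (E.dirichletSemigroup hΩ)) {t : ℝ} (ht : 0 < t)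
    (φ : Lp ℝ 2 (μ.restrict Ω)) :
    indicatorCLM hΩ.measurableSet (E.semigroup t (extendByZero hΩ.measurableSet φ)) =
      extendByZero hΩ.measurableSet (E.dirichletSemigroup hΩ t φ) := by
  set F := dirichletRestriction E.toClosedForm hΩ.measurableSet with hF
  set J := extendByZero (μ := μ) hΩ.measurableSet with hJ
  have hSD : ∀ g, E.dirichletSemigroup hΩ t g = F.semigroup t g := fun g => rfl
  let d : Lp ℝ 2 (μ.restrict Ω) → Lp ℝ 2 μ := fun g => E.semigroup t (J g) - J (F.semigroup t g)
  have hd0 : ∀ g, 0 ≤ g → 0 ≤ d g := fun g hg =>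
    sub_nonneg.2 (dirichletSemigroup_le hloc hΩ ht hg)
  have hdsub : ∀ g k, d (g - k) = d g - d k := fun g k => by
    simp only [d]
    rw [map_sub, E.semigroup_sub ht, F.semigroup_sub ht, map_sub]
    abel
  have hdsymm : ∀ g k, inner ℝ (d g) (J k) = inner ℝ (J g) (d k) := fun g k => by
    simp only [d]
    rw [inner_sub_left, inner_sub_right, E.semigroup_symm ht, J.inner_map_map, J.inner_map_map,
      F.semigroup_symm ht]
  set e := compactIndicator (μ.restrict Ω) with he
  have hdmono : ∀ m n, m ≤ n → d (e m) ≤ d (e n) := fun m n hmn => by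
    rw [← sub_nonneg, ← hdsub]
    exact hd0 _ (sub_nonneg.2 (compactIndicator_mono _ hmn))
  have hde : ∀ n, ∀ᵐ x ∂μ, x ∈ Ω → d (e n) x = 0 := fun n => by
    have h1 : ∀ m, ∀ᵐ x ∂μ, x ∈ Ω → d (e m) x ≤ 1 - F.semigroup t (e m) x := fun m => by
      filter_upwards [(semigroup_mem_unitInterval (E := E) ht
        (extendByZero_compactIndicator_mem_unitInterval hΩ.measurableSet m)).2,
        Lp.coeFn_sub (E.semigroup t (J (e m))) (J (F.semigroup t (e m))),
        coeFn_extendByZero hΩ.measurableSet (F.semigroup t (e m))] with x h1 h2 h3 hx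
      simp only [d]
      rw [h2, Pi.sub_apply, h3, Set.indicator_of_mem hx]
      exact sub_le_sub_right h1 _
    have h2 : ∀ m, ∀ᵐ x ∂μ, n ≤ m → d (e n) x ≤ d (e m) x := fun m => by
      by_cases hnm : n ≤ m
      · filter_upwards [(Lp.coeFn_le _ _).2 (hdmono n m hnm)] with x hx _ using hx
      · exact Eventually.of_forall fun x h => absurd h hnm
    filter_upwards [ae_all_iff.2 h1, ae_all_iff.2 h2, (Lp.coeFn_nonneg _).2
      (hd0 _ (compactIndicator_nonneg (μ.restrict Ω) n)),
      (ae_restrict_iff' hΩ.measurableSet).1 (isConservative_iff.1 hc t ht)] with x h1 h2 h3 h4 hx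
    refine le_antisymm ?_ h3
    have h5 := (h4 hx).const_sub 1
    rw [sub_self] at h5
    refine ge_of_tendsto h5 ?_
    filter_upwards [eventually_ge_atTop n] with m hm
    exact (h2 m hm).trans (h1 m hx)
  have hdk : ∀ k, 0 ≤ k → indicatorCLM hΩ.measurableSet (d k) = 0 := fun k hk => by
    have h1 : ∀ n, ∀ᵐ x ∂μ, d k x * J (e n) x = 0 := fun n => by
      refine mul_eq_zero_of_inner_eq_zero (hd0 k hk)
        (extendByZero_nonneg _ (compactIndicator_nonneg _ n)) ?_
      rw [hdsymm]
      refine inner_eq_zero_of_mul_eq_zero ?_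
      filter_upwards [hde n, extendByZero_ae_eq_zero hΩ.measurableSet k] with x h1 h2
      by_cases hx : x ∈ Ω
      · rw [h1 hx, mul_zero]
      · rw [h2 hx, zero_mul]
    refine Lp.ext ?_
    filter_upwards [ae_all_iff.2 h1, coeFn_indicatorCLM hΩ.measurableSet (d k),
      Lp.coeFn_zero ℝ 2 μ, ae_all_iff.2 fun n =>
        coeFn_extendByZero_compactIndicator (μ := μ) hΩ.measurableSet n] with x h1 h2 h3 h4
    rw [h2, h3, Pi.zero_apply]
    by_cases hx : x ∈ Ω
    · obtain ⟨n, hn⟩ : ∃ n, x ∈ compactCovering X n := by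
        rw [← Set.mem_iUnion, iUnion_compactCovering]
        trivial
      have h5 := h1 n
      rw [h4 n, Set.indicator_of_mem (Set.mem_inter hn hx), mul_one] at h5
      rw [Set.indicator_of_mem hx, h5]
    · rw [Set.indicator_of_notMem hx]
  have hfin : indicatorCLM hΩ.measurableSet (d φ) = 0 := by
    rw [← posPart_sub_negPart φ, hdsub, map_sub, hdk _ (posPart_nonneg φ),
      hdk _ (negPart_nonneg φ), sub_zero]
  rw [hSD, ← sub_eq_zero, ← hfin]
  simp only [d]
  rw [map_sub, hJ, indicatorCLM_extendByZero]

/-- Conservation of `S^D` implies that `S` and `S^D` agree on `L₂(Ω)`: by the semigroup property,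
`‖S_t φ‖ ^ 2 = ⟪S_{2 t} φ, φ⟫ = ⟪S^D_{2 t} φ, φ⟫ = ‖S^D_t φ‖ ^ 2`, hence `S_t φ` vanishes
outside `Ω`. -/
theorem semigroupsAgree_of_isConservative (hloc : E.IsLocal) (hΩ : IsOpen Ω)
    (hc : IsConservative (E.dirichletSemigroup hΩ)) : E.SemigroupsAgree hΩ := by
  intro φ t ht
  have key := fun {t : ℝ} (ht : 0 < t) =>
    indicatorCLM_semigroup_of_isConservative hloc hΩ hc ht φ
  set F := dirichletRestriction E.toClosedForm hΩ.measurableSet with hF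
  set J := extendByZero (μ := μ) hΩ.measurableSet with hJ
  have hSD : ∀ {t : ℝ} g, E.dirichletSemigroup hΩ t g = F.semigroup t g := fun g => rfl
  simp only [hSD] at key ⊢
  have h1 : inner ℝ (J (F.semigroup t φ)) (E.semigroup t (J φ)) = ‖J (F.semigroup t φ)‖ ^ 2 := by
    rw [hJ, ← inner_extendByZero_indicatorCLM, ← hJ, key ht, real_inner_self_eq_norm_sq]
  have h2 : ‖E.semigroup t (J φ)‖ ^ 2 = ‖J (F.semigroup t φ)‖ ^ 2 := by
    rw [← real_inner_self_eq_norm_sq, ← E.semigroup_symm ht, E.semigroup_semigroup ht ht,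
      real_inner_comm, hJ, ← inner_extendByZero_indicatorCLM, ← hJ, key (add_pos ht ht),
      J.inner_map_map, ← F.semigroup_semigroup ht ht, ← F.semigroup_symm ht,
      real_inner_self_eq_norm_sq, J.norm_map]
  have h3 := norm_sub_sq_real (J (F.semigroup t φ)) (E.semigroup t (J φ))
  rw [h1, h2] at h3
  have h4 : ‖J (F.semigroup t φ) - E.semigroup t (J φ)‖ ^ 2 = 0 := by rw [h3]; ring
  have h5 : J (F.semigroup t φ) - E.semigroup t (J φ) = 0 := by simpa using h4
  exact (sub_eq_zero.1 h5).symm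

theorem isConservative_of_semigroupsAgree (hΩ : IsOpen Ω) (hc : IsConservative E.semigroup)
    (h : E.SemigroupsAgree hΩ) : IsConservative (E.dirichletSemigroup hΩ) := by
  rw [isConservative_iff] at hc ⊢
  intro t ht
  rw [ae_restrict_iff' hΩ.measurableSet]
  set F := dirichletRestriction E.toClosedForm hΩ.measurableSet with hF
  set J := extendByZero (μ := μ) hΩ.measurableSet with hJ
  have hSD : ∀ g, E.dirichletSemigroup hΩ t g = F.semigroup t g := fun g => rfl
  simp only [hSD]
  have key : ∀ n, ∀ᵐ x ∂μ, x ∈ Ω → E.semigroup t (compactIndicator μ n) x =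
      F.semigroup t (compactIndicator (μ.restrict Ω) n) x := fun n => by
    set r := compactIndicator μ n - J (compactIndicator (μ.restrict Ω) n) with hr
    have hr0 : ∀ᵐ x ∂μ, x ∈ Ω → r x = 0 := by
      filter_upwards [coeFn_compactIndicator μ n,
        coeFn_extendByZero_compactIndicator (μ := μ) hΩ.measurableSet n,
        Lp.coeFn_sub (compactIndicator μ n) (J (compactIndicator (μ.restrict Ω) n))]
        with x h1 h2 h3 hx
      rw [hr, h3, Pi.sub_apply, h1, h2]
      by_cases hK : x ∈ compactCovering X n <;> simp [hx, hK]
    -- By symmetry, `S_t` maps functions vanishing on `Ω` to functions vanishing on `Ω`.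
    have hSr : indicatorCLM hΩ.measurableSet (E.semigroup t r) = 0 := by
      rw [← inner_self_eq_zero (𝕜 := ℝ)]
      nth_rewrite 1 [indicatorCLM_apply]
      rw [inner_extendByZero_indicatorCLM, real_inner_comm, E.semigroup_symm ht, h _ t ht]
      refine inner_eq_zero_of_mul_eq_zero ?_
      filter_upwards [hr0, extendByZero_ae_eq_zero hΩ.measurableSet (E.dirichletSemigroup hΩ t
        (LpToLpRestrictCLM X ℝ ℝ μ 2 Ω (E.semigroup t r)))] with x h1 h2
      by_cases hx : x ∈ Ω
      · rw [h1 hx, zero_mul]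
      · rw [h2 hx, mul_zero]
    rw [hr, E.semigroup_sub ht, h _ t ht, map_sub, indicatorCLM_extendByZero, sub_eq_zero] at hSr
    filter_upwards [coeFn_indicatorCLM hΩ.measurableSet (E.semigroup t (compactIndicator μ n)),
      coeFn_extendByZero hΩ.measurableSet
        (E.dirichletSemigroup hΩ t (compactIndicator (μ.restrict Ω) n))] with x h1 h2 hx
    rw [hSr, h2, Set.indicator_of_mem hx, Set.indicator_of_mem hx] at h1
    exact h1.symm
  filter_upwards [ae_all_iff.2 key, hc t ht] with x h1 h2 hx
  exact h2.congr fun n => h1 n hx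

end Conservation

/-! ### Cutting off functions in the form domain -/

theorem normSq_indicator_le {X : Type*} [MeasurableSpace X] {μ : Measure X} {E : DirichletForm μ}
    {Ω : Set X} (hloc : E.IsLocal) (hΩ : MeasurableSet Ω)
    {u w : E.domain} (hw : (w : Lp ℝ 2 μ) = indicatorCLM hΩ (u : Lp ℝ 2 μ)) : E.normSq w ≤ E.normSq u := by
  have h := normSq_add_of_mul_eq_zero hloc (u := w) (v := u - w) (by
    have := indicatorCLM_mul_sub hΩ (u : Lp ℝ 2 μ) (u : Lp ℝ 2 μ)
    rw [← hw] at this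
    exact this)
  rw [add_sub_cancel] at h
  have := E.normSq_nonneg (u - w)
  linarith

section Cut

variable {X : Type*} [TopologicalSpace X] [SecondCountableTopology X] [MeasurableSpace X]
  {μ : Measure X} {E : DirichletForm μ} {Ω : Set X}

/-- If the resolvent of `E` restricts to that of `E_D`, then multiplication by the indicator
function of `Ω` maps the form domain into the domain of `E_D`. Indeed the functions
`w = β (β + A_D)⁻¹ (𝟙_Ω u)` satisfy `β ‖𝟙_Ω u - w‖ ^ 2 + E(w, w) = E(w, u)`, so that they are
bounded in the graph norm and converge to `𝟙_Ω u` as `β → ∞`. -/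
theorem indicator_mem_of_resolvent_agree (hΩ : MeasurableSet Ω)
    (h : ∀ (γ : ℝ) (g : Lp ℝ 2 (μ.restrict Ω)), 0 < γ → E.resolvent γ (extendByZero hΩ g) =
      extendByZero hΩ ((dirichletRestriction E.toClosedForm hΩ).resolvent γ g)) (u : E.domain) :
    ∃ w ∈ E.graphClosure (compactSupportDomain E.toClosedForm Ω),
      (w : Lp ℝ 2 μ) = indicatorCLM hΩ (u : Lp ℝ 2 μ) := by
  set v := indicatorCLM hΩ (u : Lp ℝ 2 μ) with hv
  have hex : ∀ β : ℝ, 0 < β → ∃ w ∈ E.graphClosure (compactSupportDomain E.toClosedForm Ω),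
      ∀ k : E.domain, E.form w k = β * inner ℝ (v - w) (k : Lp ℝ 2 μ) := fun β hβ => by
    obtain ⟨w, hw, hwv, -⟩ := exists_dirichlet_resolvent (E := E) hΩ hβ
      (LpToLpRestrictCLM X ℝ ℝ μ 2 Ω (u : Lp ℝ 2 μ))
    have hwR : w = E.resolventFun hβ v := Subtype.ext (by
      rw [hwv, ← h β _ hβ, ← E.resolvent_apply hβ, hv, indicatorCLM_apply])
    refine ⟨β • w, Submodule.smul_mem _ _ hw, fun k => ?_⟩
    have h1 := E.resolventFun_spec hβ v k
    rw [← hwR] at h1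
    rw [map_smul, LinearMap.smul_apply, Submodule.coe_smul, inner_sub_left, inner_smul_left,
      smul_eq_mul, ← h1]
    simp only [conj_trivial]
    ring
  choose w hw hspec using fun n : ℕ => hex ((n : ℝ) + 1) (by positivity)
  have hcut : ∀ n, inner ℝ (v - w n) (u : Lp ℝ 2 μ) = inner ℝ (v - w n) v := fun n => by
    have e : v - w n = extendByZero hΩ (LpToLpRestrictCLM X ℝ ℝ μ 2 Ω (u - w n : Lp ℝ 2 μ)) := by
      rw [← indicatorCLM_apply, map_sub, indicatorCLM_of_mem_graphClosure hΩ (hw n)]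
    rw [hv, e, inner_extendByZero_indicatorCLM]
  have hE : ∀ n : ℕ, ((n : ℝ) + 1) * ‖v - w n‖ ^ 2 + E.form (w n) (w n) = E.form (w n) u := fun n => by
    rw [hspec n u, hspec n (w n), hcut, ← mul_add, ← real_inner_self_eq_norm_sq, ← inner_add_right,
      sub_add_cancel]
  have hCS : ∀ n, 2 * E.form (w n) u ≤ E.form (w n) (w n) + E.form u u := fun n => by
    have h1 := E.nonneg (w n - u)
    simp only [map_sub, LinearMap.sub_apply] at h1
    rw [E.symm u (w n)] at h1
    linarith
  have hwE : ∀ n, E.form (w n) (w n) ≤ E.form u u := fun n => by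
    have h1 := hE n
    have h2 := hCS n
    have h3 : 0 ≤ ((n : ℝ) + 1) * ‖v - w n‖ ^ 2 := by positivity
    linarith
  have hdist : ∀ n : ℕ, ‖v - w n‖ ^ 2 ≤ E.form u u * (1 / ((n : ℝ) + 1)) := fun n => by
    have h1 := hE n
    have h2 := hCS n
    have h3 := E.nonneg (w n)
    have h4 := E.nonneg u
    have h5 : (0 : ℝ) < (n : ℝ) + 1 := by positivity
    rw [mul_one_div, le_div_iff₀ h5]
    linarith
  have hlim : Tendsto (fun n => (w n : Lp ℝ 2 μ)) atTop (𝓝 v) := by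
    rw [tendsto_iff_norm_sub_tendsto_zero]
    have h1 := (tendsto_one_div_add_atTop_nhds_zero_nat (𝕜 := ℝ)).const_mul (E.form u u)
    rw [mul_zero] at h1
    have h2 := (Real.continuous_sqrt.tendsto 0).comp h1
    rw [Real.sqrt_zero] at h2
    refine squeeze_zero (fun _ => norm_nonneg _) (fun n => Real.le_sqrt_of_sq_le ?_) h2
    rw [norm_sub_rev]
    exact hdist n
  obtain ⟨C, hC⟩ := hlim.norm.bddAbove_range
  refine E.exists_mem_graphClosure_of_tendsto hw (C := E.form u u + C ^ 2) (fun n => ?_) hlim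
  have h1 : ‖(w n : Lp ℝ 2 μ)‖ ≤ C := hC ⟨n, rfl⟩
  unfold ClosedForm.normSq
  have := hwE n
  gcongr

/-- If multiplication by the indicator function of `Ω` maps the form domain into the domain of
`E_D`, then by locality `S` restricts to `S^D`. -/
theorem semigroupsAgree_of_indicator_mem [OpensMeasurableSpace X] (hloc : E.IsLocal) (hΩ : IsOpen Ω)
    (h : ∀ u : E.domain, ∃ w ∈ E.graphClosure (compactSupportDomain E.toClosedForm Ω),
      (w : Lp ℝ 2 μ) = indicatorCLM hΩ.measurableSet (u : Lp ℝ 2 μ)) :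
    E.SemigroupsAgree hΩ := by
  intro φ t ht
  refine E.semigroup_agree_of_resolvent_agree _ _ (fun γ g hγ => ?_) ht φ
  obtain ⟨w, hw, hwg, hspec⟩ := exists_dirichlet_resolvent (E := E) hΩ.measurableSet hγ g
  rw [← hwg, E.resolvent_apply hγ]
  congr 1
  refine (E.resolvent_unique hγ fun v => ?_).symm
  rw [E.resolventFun_spec hγ]
  obtain ⟨v₁, hv₁, hv₁v⟩ := h v
  have h0 : ∀ k : Lp ℝ 2 μ, indicatorCLM hΩ.measurableSet k = k →
      ∀ᵐ x ∂μ, k x * ((v - v₁ : E.domain) : Lp ℝ 2 μ) x = 0 := fun k hk => by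
    have := indicatorCLM_mul_sub hΩ.measurableSet k (v : Lp ℝ 2 μ)
    rw [hk, ← hv₁v] at this
    exact this
  have hw0 := h0 w (indicatorCLM_of_mem_graphClosure hΩ.measurableSet hw)
  have h1 := hloc w (v - v₁) hw0
  have h2 := inner_eq_zero_of_mul_eq_zero hw0
  have h3 := inner_eq_zero_of_mul_eq_zero
    (h0 (extendByZero hΩ.measurableSet g) (indicatorCLM_extendByZero hΩ.measurableSet g))
  rw [map_sub] at h1
  rw [Submodule.coe_sub, inner_sub_right] at h2 h3
  have h4 := hspec v₁ hv₁
  have h5 : inner ℝ (w : Lp ℝ 2 μ) (v : Lp ℝ 2 μ) = inner ℝ (w : Lp ℝ 2 μ) (v₁ : Lp ℝ 2 μ) := by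
    linarith
  rw [h5]
  linarith

end Cut

/-! ### Relative capacity -/

section Capacity

variable {X : Type*} [TopologicalSpace X] [MeasurableSpace X] {μ : Measure X}
  {E : DirichletForm μ}

theorem relCapacity_eq_zero_iff {Ω A : Set X} : E.relCapacity Ω A = 0 ↔
    ∀ ε : ℝ, 0 < ε → ∃ u : E.domain, (∃ V : Set X, IsOpen V ∧ A ⊆ V ∧
      ∀ᵐ x ∂μ, x ∈ V ∩ Ω → 1 ≤ (u : Lp ℝ 2 μ) x) ∧ E.normSq u < ε := by
  constructor
  · intro h ε hε
    have h1 : E.relCapacity Ω A < ENNReal.ofReal ε := by rw [h]; exact ENNReal.ofReal_pos.2 hε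
    obtain ⟨u, hu⟩ := iInf_lt_iff.1 h1
    obtain ⟨hV, hlt⟩ := iInf_lt_iff.1 hu
    exact ⟨u, hV, (ENNReal.ofReal_lt_ofReal_iff hε).1 hlt⟩
  · intro h
    refine nonpos_iff_eq_zero.1 (ENNReal.le_of_forall_pos_le_add fun ε hε _ => ?_)
    obtain ⟨u, hV, hlt⟩ := h ε hε
    rw [zero_add]
    refine (iInf₂_le u hV).trans ?_
    rw [← ENNReal.ofReal_coe_nnreal]
    exact ENNReal.ofReal_le_ofReal hlt.le

/-- The relative capacity vanishes on countable unions of sets of relative capacity zero. -/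
theorem relCapacity_iUnion_eq_zero (hloc : E.IsLocal) {Ω : Set X} {A : ℕ → Set X}
    (hA : ∀ n, E.relCapacity Ω (A n) = 0) : E.relCapacity Ω (⋃ n, A n) = 0 := by
  rw [relCapacity_eq_zero_iff]
  intro ε hε
  choose u hu hlt using fun n => relCapacity_eq_zero_iff.1 (hA n) (ε / 3 / 4 ^ (n + 1))
    (by positivity)
  choose V hV hAV huV using hu
  let f : ℕ → E.domain := fun n => ⟨(u n : Lp ℝ 2 μ)⁺, E.pos_mem (u n).2⟩
  obtain ⟨w, hw, hwε⟩ := E.exists_sum (f := f) (ε := ε / 3)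
    (fun n => (normSq_pos_le hloc (u n).2).trans (hlt n).le)
  have hle : ∀ n, (u n : Lp ℝ 2 μ) ≤ w := fun n => by
    refine ge_of_tendsto hw ?_
    filter_upwards [eventually_gt_atTop n] with k hk
    rw [AddSubmonoidClass.coe_finsetSum]
    exact (le_posPart _).trans (Finset.single_le_sum (f := fun i => (f i : Lp ℝ 2 μ))
      (fun i _ => posPart_nonneg _) (Finset.mem_range.2 hk))
  refine ⟨w, ⟨⋃ n, V n, isOpen_iUnion hV, Set.iUnion_mono hAV, ?_⟩, by linarith⟩
  filter_upwards [ae_all_iff.2 huV, ae_all_iff.2 fun n => (Lp.coeFn_le _ _).2 (hle n)]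
    with x h1 h2 hx
  obtain ⟨n, hn⟩ := Set.mem_iUnion.1 hx.1
  exact (h1 n ⟨hn, hx.2⟩).trans (h2 n)

end Capacity

/-- Cutoff functions in the form domain. They are obtained as `0 ∨ (f ∨ 0 - 0 ∨ f ∧ 1) ∧ 1`, that is
`(f - 1)⁺ ∧ 1`, from a uniform approximation `f` of three times a continuous cutoff function. -/
theorem exists_cutoff {X : Type*} [MetricSpace X] [LocallyCompactSpace X] [MeasurableSpace X]
    {μ : Measure X} {E : DirichletForm μ} (hC0 : E.DenseInC0) {K U : Set X} (hK : IsCompact K)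
    (hU : IsOpen U) (hKU : K ⊆ U) :
    ∃ χ : E.domain, ∀ᵐ x ∂μ, 0 ≤ (χ : Lp ℝ 2 μ) x ∧ (x ∈ K → (χ : Lp ℝ 2 μ) x = 1) ∧
      (x ∉ U → (χ : Lp ℝ 2 μ) x = 0) := by
  obtain ⟨f, hfK, hfU, hfc, -⟩ := exists_continuous_one_zero_of_isCompact hK hU.isClosed_compl
    (Set.disjoint_compl_right_iff_subset.2 hKU)
  have hgc : HasCompactSupport (fun x => 3 * f x) := hfc.mul_left (f := fun _ => (3 : ℝ))
  let g : C₀(X, ℝ) :=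
    { toFun := fun x => 3 * f x
      continuous_toFun := by fun_prop
      zero_at_infty' := hgc.is_zero_at_infty }
  obtain ⟨h, ⟨-, u, hu⟩, hgh⟩ := hC0.exists_dist_lt g one_pos
  have hclose : ∀ x, |3 * f x - h x| < 1 := fun x => by
    have h1 := BoundedContinuousFunction.dist_coe_le_dist (f := g.toBCF) (g := h.toBCF) x
    exact lt_of_le_of_lt h1 hgh
  obtain ⟨p, hp, -⟩ := E.markov u
  obtain ⟨χ, hχ, -⟩ := E.markov (⟨(u : Lp ℝ 2 μ)⁺, E.pos_mem u.2⟩ - p)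
  refine ⟨χ, ?_⟩
  filter_upwards [hu, hp, hχ, coeFn_pos (u : Lp ℝ 2 μ),
    Lp.coeFn_sub (u : Lp ℝ 2 μ)⁺ (p : Lp ℝ 2 μ)] with x h1 h2 h3 h4 h5
  have h6 := hclose x
  have h7 : (χ : Lp ℝ 2 μ) x = max 0 (min (max (h x) 0 - max 0 (min (h x) 1)) 1) := by
    rw [h3, Submodule.coe_sub, h5, Pi.sub_apply, h4, h2, h1]
  rw [h7]
  rw [abs_lt] at h6
  refine ⟨le_max_left _ _, ?_, ?_⟩
  · intro hx
    rw [hfK hx, Pi.one_apply] at h6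
    have h8 : 2 < h x := by linarith
    have h9 : max (h x) 0 = h x := max_eq_left (by linarith)
    have h10 : min (h x) 1 = 1 := min_eq_right (by linarith)
    have h11 : min (h x - 1) 1 = 1 := min_eq_right (by linarith)
    rw [h9, h10, max_eq_right zero_le_one, h11, max_eq_right zero_le_one]
  · intro hx
    rw [hfU hx, Pi.zero_apply] at h6
    have h8 : h x < 1 := by linarith
    rw [min_eq_left h8.le, max_comm 0 (h x), sub_self, min_eq_left zero_le_one, max_self]

section Boundary

variable {X : Type*} [MetricSpace X] [LocallyCompactSpace X] [MeasurableSpace X]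
  [BorelSpace X] {μ : Measure X} {E : DirichletForm μ} {Ω : Set X}

/-- If multiplication by the indicator function of `Ω` maps the form domain into the domain of
`E_D`, then `∂Ω` has relative capacity zero: cover `∂Ω` by countably many compact sets, and use the
differences of `𝟙_Ω χ`, for a cutoff function `χ`, and its approximations with compact support
in `Ω`. -/
theorem relCapacity_frontier_eq_zero [SigmaCompactSpace X] (hC0 : E.DenseInC0) (hloc : E.IsLocal)
    (hΩ : IsOpen Ω)
    (h : ∀ u : E.domain, ∃ w ∈ E.graphClosure (compactSupportDomain E.toClosedForm Ω),
      (w : Lp ℝ 2 μ) = indicatorCLM hΩ.measurableSet (u : Lp ℝ 2 μ)) :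
    E.relCapacity Ω (frontier Ω) = 0 := by
  have hcover : frontier Ω = ⋃ n, compactCovering X n ∩ frontier Ω := by
    rw [← Set.iUnion_inter, iUnion_compactCovering, Set.univ_inter]
  rw [hcover]
  refine relCapacity_iUnion_eq_zero hloc fun n => relCapacity_eq_zero_iff.2 fun ε hε => ?_
  obtain ⟨K, hK, hKn⟩ := exists_compact_superset (isCompact_compactCovering X n)
  obtain ⟨χ, hχ⟩ := exists_cutoff hC0 hK isOpen_univ (Set.subset_univ K)
  obtain ⟨w, hw, hwχ⟩ := h χ
  obtain ⟨v, hv, hvw⟩ := hw ε hε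
  -- Near the boundary, `𝟙_Ω χ - v` coincides with `𝟙_Ω` as `v` has compact support in `Ω`.
  refine ⟨w - v, ⟨interior K \ essSupport (v : Lp ℝ 2 μ),
    isOpen_interior.sdiff (isClosed_essSupport _), fun x hx => ⟨hKn hx.1, fun hxv => ?_⟩, ?_⟩, hvw⟩
  · rw [hΩ.frontier_eq] at hx
    exact hx.2.2 (hv.2 hxv)
  · filter_upwards [hχ, coeFn_indicatorCLM hΩ.measurableSet (χ : Lp ℝ 2 μ),
      ae_eq_zero_of_notMem_essSupport (v : Lp ℝ 2 μ),
      Lp.coeFn_sub (w : Lp ℝ 2 μ) (v : Lp ℝ 2 μ)] with x h1 h2 h3 h4 hx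
    rw [Submodule.coe_sub, h4, Pi.sub_apply, h3 hx.1.2, hwχ, h2, Set.indicator_of_mem hx.2,
      h1.2.1 (interior_subset hx.1.1), sub_zero]

/-- If `∂Ω` has relative capacity zero, then multiplication by the indicator function of `Ω` maps
bounded nonnegative functions with compact support in the form domain into the domain of `E_D`:
subtracting from such a function `u ≤ M` multiples `M φ` of functions `φ` with small graph norm
which are at least `1` on `Ω` near `∂Ω`, one obtains functions `(u - M φ)⁺` whose restrictions to
`Ω` have compact support in `Ω`. -/
theorem indicator_mem_of_nonneg (hC0 : E.DenseInC0) (hloc : E.IsLocal) (hΩ : IsOpen Ω)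
    (hcap : E.relCapacity Ω (frontier Ω) = 0) {u : E.domain} (hu0 : 0 ≤ (u : Lp ℝ 2 μ))
    {M : ℝ} (hM0 : 0 ≤ M) (hM : ∀ᵐ x ∂μ, (u : Lp ℝ 2 μ) x ≤ M) {L : Set X} (hL : IsCompact L)
    (huL : ∀ᵐ x ∂μ, x ∉ L → (u : Lp ℝ 2 μ) x = 0) :
    ∃ w ∈ E.graphClosure (compactSupportDomain E.toClosedForm Ω),
      (w : Lp ℝ 2 μ) = indicatorCLM hΩ.measurableSet (u : Lp ℝ 2 μ) := by
  have hex : ∀ ε : ℝ, 0 < ε → ∃ φ : E.domain, 0 ≤ (φ : Lp ℝ 2 μ) ∧ E.normSq φ < ε ∧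
      ∃ w ∈ compactSupportDomain E.toClosedForm Ω, (w : Lp ℝ 2 μ) =
        indicatorCLM hΩ.measurableSet (((u - M • φ : E.domain) : Lp ℝ 2 μ)⁺) := fun ε hε => by
    obtain ⟨ψ, ⟨V, hVo, hV, hψV⟩, hψ⟩ := relCapacity_eq_zero_iff.1 hcap ε hε
    set φ : E.domain := ⟨(ψ : Lp ℝ 2 μ)⁺, E.pos_mem ψ.2⟩ with hφ
    have hφ0 : 0 ≤ (φ : Lp ℝ 2 μ) := posPart_nonneg _
    refine ⟨φ, hφ0, (normSq_pos_le hloc ψ.2).trans_lt hψ, ?_⟩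
    have hφV : ∀ᵐ x ∂μ, x ∈ V ∩ Ω → 1 ≤ (φ : Lp ℝ 2 μ) x := by
      filter_upwards [hψV, (Lp.coeFn_le _ _).2 (le_posPart (ψ : Lp ℝ 2 μ))] with x h1 h2 hx
      exact (h1 hx).trans h2
    have hKc : IsCompact ((L ∩ closure Ω) \ V) := (hL.inter_right isClosed_closure).diff hVo
    have hKΩ : (L ∩ closure Ω) \ V ⊆ Ω := fun x hx => by
      by_contra hxΩ
      exact hx.2 (hV (by rw [hΩ.frontier_eq]; exact ⟨hx.1.2, hxΩ⟩))
    obtain ⟨χ, hχ⟩ := exists_cutoff hC0 hKc hΩ hKΩ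
    set p := ((u - M • φ : E.domain) : Lp ℝ 2 μ)⁺ with hp
    have hpx : ∀ᵐ x ∂μ, p x = max ((u : Lp ℝ 2 μ) x - M * (φ : Lp ℝ 2 μ) x) 0 := by
      filter_upwards [coeFn_pos ((u - M • φ : E.domain) : Lp ℝ 2 μ),
        Lp.coeFn_sub (u : Lp ℝ 2 μ) (M • φ : Lp ℝ 2 μ), Lp.coeFn_smul M (φ : Lp ℝ 2 μ)]
        with x h1 h2 h3
      rw [h1, Submodule.coe_sub, Submodule.coe_smul, h2, Pi.sub_apply, h3, Pi.smul_apply,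
        smul_eq_mul]
    have hpK : ∀ᵐ x ∂μ, x ∈ Ω → x ∉ (L ∩ closure Ω) \ V → p x = 0 := by
      filter_upwards [hpx, hφV, huL, hM, (Lp.coeFn_nonneg _).2 hφ0] with x h1 h2 h3 h4 h5 hxΩ hxK
      have h5' : 0 ≤ (φ : Lp ℝ 2 μ) x := h5
      rw [h1]
      refine max_eq_right ?_
      by_cases hxV : x ∈ V
      · have := mul_le_mul_of_nonneg_left (h2 ⟨hxV, hxΩ⟩) hM0
        linarith
      · have hxL : x ∉ L := fun hxL => hxK ⟨⟨hxL, subset_closure hxΩ⟩, hxV⟩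
        rw [h3 hxL]
        have := mul_nonneg hM0 h5'
        linarith
    have hw : p ⊓ ((M • χ : E.domain) : Lp ℝ 2 μ) = indicatorCLM hΩ.measurableSet p := by
      refine Lp.ext ?_
      filter_upwards [hpx, hpK, hχ, hM, (Lp.coeFn_nonneg _).2 hφ0,
        Lp.coeFn_inf p ((M • χ : E.domain) : Lp ℝ 2 μ), Lp.coeFn_smul M (χ : Lp ℝ 2 μ),
        coeFn_indicatorCLM hΩ.measurableSet p, (Lp.coeFn_nonneg _).2 (posPart_nonneg _ : 0 ≤ p)]
        with x h1 h2 h3 h4 h5 h6 h7 h8 h9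
      have h5' : 0 ≤ M * (φ : Lp ℝ 2 μ) x := mul_nonneg hM0 h5
      have h9' : 0 ≤ p x := h9
      have hpM : p x ≤ M := by
        rw [h1]
        exact max_le (by linarith) hM0
      rw [h6, h8, Pi.inf_apply, Submodule.coe_smul, h7, Pi.smul_apply, smul_eq_mul]
      by_cases hxΩ : x ∈ Ω
      · rw [Set.indicator_of_mem hxΩ]
        by_cases hxK : x ∈ (L ∩ closure Ω) \ V
        · rw [h3.2.1 hxK, mul_one]
          exact inf_eq_left.2 hpM
        · rw [h2 hxΩ hxK]
          exact inf_eq_left.2 (mul_nonneg hM0 h3.1)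
      · rw [Set.indicator_of_notMem hxΩ, h3.2.2 hxΩ, mul_zero]
        exact inf_eq_right.2 h9'
    refine ⟨⟨_, E.inf_mem (E.pos_mem (u - M • φ).2) (M • χ).2⟩, ?_, hw⟩
    have hs : essSupport (p ⊓ ((M • χ : E.domain) : Lp ℝ 2 μ)) ⊆ (L ∩ closure Ω) \ V := by
      refine essSupport_subset_of_ae hKc.isClosed ?_
      rw [hw]
      filter_upwards [coeFn_indicatorCLM hΩ.measurableSet p, hpK] with x h1 h2 hxK
      rw [h1]
      by_cases hxΩ : x ∈ Ω
      · rw [Set.indicator_of_mem hxΩ, h2 hxΩ hxK]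
      · rw [Set.indicator_of_notMem hxΩ]
    exact ⟨hKc.of_isClosed_subset (isClosed_essSupport _) hs, hs.trans hKΩ⟩
  choose φ hφ0 hφ w hw hwφ using fun n : ℕ => hex (1 / ((n : ℝ) + 1)) Nat.one_div_pos_of_nat
  have hφ1 : ∀ n, E.normSq (φ n) ≤ 1 := fun n => (hφ n).le.trans (by
    simpa using Nat.one_div_le_one_div (α := ℝ) (Nat.zero_le n))
  have hφlim : Tendsto (fun n => (φ n : Lp ℝ 2 μ)) atTop (𝓝 ((0 : E.domain) : Lp ℝ 2 μ)) := by
    refine E.tendsto_coe_of_tendsto_normSq (squeeze_zero (fun n => E.normSq_nonneg _) (fun n => ?_)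
      (tendsto_one_div_add_atTop_nhds_zero_nat (𝕜 := ℝ)))
    rw [sub_zero]
    exact (hφ n).le
  refine E.exists_mem_graphClosure_of_tendsto (fun n => E.mem_graphClosure_of_mem (hw n))
    (C := 2 * E.normSq u + 2 * (M ^ 2 * 1)) (fun n => ?_) ?_
  · refine (normSq_indicator_le hloc hΩ.measurableSet
      (u := ⟨_, E.pos_mem (u - M • φ n).2⟩) (hwφ n)).trans ?_
    refine (normSq_pos_le hloc (u - M • φ n).2).trans ((E.normSq_sub_le u (M • φ n)).trans ?_)
    rw [E.normSq_smul]
    have := hφ1 n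
    gcongr
  · have h1 : Tendsto (fun n => (u : Lp ℝ 2 μ) - M • (φ n : Lp ℝ 2 μ)) atTop
        (𝓝 ((u : Lp ℝ 2 μ) - M • ((0 : E.domain) : Lp ℝ 2 μ))) :=
      (hφlim.const_smul M).const_sub _
    rw [Submodule.coe_zero, smul_zero, sub_zero] at h1
    have h2 := (continuous_posPart.tendsto _).comp h1
    rw [posPart_of_nonneg hu0] at h2
    have h3 := ((indicatorCLM hΩ.measurableSet).continuous.tendsto _).comp h2
    refine h3.congr fun n => ?_
    rw [hwφ n]
    rfl

theorem indicator_mem_of_isRegular (hreg : E.IsRegular) (hloc : E.IsLocal) (hΩ : IsOpen Ω)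
    (hcap : E.relCapacity Ω (frontier Ω) = 0) (u : E.domain) :
    ∃ w ∈ E.graphClosure (compactSupportDomain E.toClosedForm Ω),
      (w : Lp ℝ 2 μ) = indicatorCLM hΩ.measurableSet (u : Lp ℝ 2 μ) := by
  have hcc : ∀ v : E.domain, (∃ f : X → ℝ, Continuous f ∧ HasCompactSupport f ∧
      ((v : Lp ℝ 2 μ) : X → ℝ) =ᵐ[μ] f) →
      ∃ w ∈ E.graphClosure (compactSupportDomain E.toClosedForm Ω),
        (w : Lp ℝ 2 μ) = indicatorCLM hΩ.measurableSet (v : Lp ℝ 2 μ) := by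
    rintro v ⟨f, hf, hfc, hvf⟩
    obtain ⟨M, hM⟩ := hf.bounded_above_of_compact_support hfc
    have hM0 : 0 ≤ max M 0 := le_max_right _ _
    obtain ⟨w₁, hw₁, hw₁v⟩ := indicator_mem_of_nonneg hreg.1 hloc hΩ hcap
      (u := ⟨(v : Lp ℝ 2 μ)⁺, E.pos_mem v.2⟩) (posPart_nonneg _) hM0 (by
        filter_upwards [coeFn_pos (v : Lp ℝ 2 μ), hvf] with x h1 h2
        rw [h1, h2]
        exact max_le_max ((le_abs_self _).trans (hM x)) le_rfl) hfc.isCompact (by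
        filter_upwards [coeFn_pos (v : Lp ℝ 2 μ), hvf] with x h1 h2 hx
        rw [h1, h2, image_eq_zero_of_notMem_tsupport hx, max_self])
    obtain ⟨w₂, hw₂, hw₂v⟩ := indicator_mem_of_nonneg hreg.1 hloc hΩ hcap
      (u := ⟨(v : Lp ℝ 2 μ)⁻, E.neg_part_mem v.2⟩) (negPart_nonneg _) hM0 (by
        filter_upwards [coeFn_neg_part (v : Lp ℝ 2 μ), hvf] with x h1 h2
        rw [h1, h2]
        exact max_le_max ((neg_le_abs _).trans (hM x)) le_rfl) hfc.isCompact (by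
        filter_upwards [coeFn_neg_part (v : Lp ℝ 2 μ), hvf] with x h1 h2 hx
        rw [h1, h2, image_eq_zero_of_notMem_tsupport hx, neg_zero, max_self])
    refine ⟨w₁ - w₂, sub_mem hw₁ hw₂, ?_⟩
    rw [Submodule.coe_sub, hw₁v, hw₂v, ← map_sub]
    show indicatorCLM hΩ.measurableSet ((v : Lp ℝ 2 μ)⁺ - (v : Lp ℝ 2 μ)⁻) = _
    rw [posPart_sub_negPart]
  choose v hv hvu using fun n : ℕ => hreg.2 u (1 / ((n : ℝ) + 1)) Nat.one_div_pos_of_nat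
  choose w hw hwv using fun n => hcc (v n) (hv n)
  refine E.exists_mem_graphClosure_of_tendsto hw (C := 2 * E.normSq u + 2) (fun n => ?_) ?_
  · refine (normSq_indicator_le hloc hΩ.measurableSet (hwv n)).trans ?_
    have h1 := E.normSq_sub_le u (u - v n)
    rw [sub_sub_cancel] at h1
    have h2 : 1 / ((n : ℝ) + 1) ≤ 1 := by
      simpa using Nat.one_div_le_one_div (α := ℝ) (Nat.zero_le n)
    linarith [hvu n]
  · have h1 : Tendsto (fun n => (v n : Lp ℝ 2 μ)) atTop (𝓝 (u : Lp ℝ 2 μ)) := by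
      refine E.tendsto_coe_of_tendsto_normSq (squeeze_zero (fun n => E.normSq_nonneg _)
        (fun n => ?_) (tendsto_one_div_add_atTop_nhds_zero_nat (𝕜 := ℝ)))
      rw [← neg_sub, E.normSq_neg]
      exact (hvu n).le
    refine (((indicatorCLM hΩ.measurableSet).continuous.tendsto _).comp h1).congr fun n => ?_
    rw [hwv n]
    rfl

end Boundary

end DirichletForm

theorem theorem1p1 {X : Type*} [MetricSpace X] [LocallyCompactSpace X] [SigmaCompactSpace X]
    [MeasurableSpace X] [BorelSpace X] (μ : Measure X) [μ.Regular] [μ.IsOpenPosMeasure]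
    (E : DirichletForm μ) (hC0 : E.DenseInC0) (hloc : E.IsLocal)
    (Ω : Set X) (hΩ : IsOpen Ω) :
    (DirichletForm.IsConservative (E.dirichletSemigroup hΩ) → E.SemigroupsAgree hΩ) ∧
    (E.SemigroupsAgree hΩ → E.relCapacity Ω (frontier Ω) = 0) ∧
    (DirichletForm.IsConservative (E.dirichletSemigroup hΩ) → E.IsInvariant hΩ) ∧
    (E.SemigroupsAgree hΩ → E.IsInvariant hΩ) ∧
    (DirichletForm.IsConservative E.semigroup → E.SemigroupsAgree hΩ →
      DirichletForm.IsConservative (E.dirichletSemigroup hΩ)) ∧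
    (E.IsRegular → E.relCapacity Ω (frontier Ω) = 0 → E.SemigroupsAgree hΩ) := by
  refine ⟨DirichletForm.semigroupsAgree_of_isConservative hloc hΩ, fun h => ?_, fun h =>
    DirichletForm.isInvariant_of_semigroupsAgree hΩ
      (DirichletForm.semigroupsAgree_of_isConservative hloc hΩ h),
    DirichletForm.isInvariant_of_semigroupsAgree hΩ,
    DirichletForm.isConservative_of_semigroupsAgree hΩ, fun hreg hcap => ?_⟩
  · exact DirichletForm.relCapacity_frontier_eq_zero hC0 hloc hΩ
      (DirichletForm.indicator_mem_of_resolvent_agree hΩ.measurableSet fun γ g hγ =>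
        E.resolvent_agree_of_semigroup_agree _ _ E.dense (fun g t ht => h g t ht) hγ g)
  · exact DirichletForm.semigroupsAgree_of_indicator_mem hloc hΩ
      (DirichletForm.indicator_mem_of_isRegular hreg hloc hΩ hcap)
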